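/- All rings are associative with identity. Let $R$ be a subring (with the same identity) of a ring $A$, and let $A=\sigma(R)\langle x_1,\dots,x_n\rangle$ be a skew PBW extension of $R$: the standard monomials $x^{\alpha}=x_1^{\alpha_1}\cdots x_n^{\alpha_n}$ $(\alpha\in\mathbb N^n)$ form a basis of $A$ as a left $R$-module; for all $i$ and all $0\ne r\in R$ there is $0\neq c_{i,r}\in R$ with $x_ir-c_{i,r}x_i\in R$; and for all $i,j$ there is $0\ne d_{i,j}\in R$ with $x_jx_i-d_{i,j}x_ix_j\in R+Rx_1+\dots+Rx_n$. Let $\sigma_i,\delta_i:R\to R$ be the maps determined by $x_ir=\sigma_i(r)x_i+\delta_i(r)$ $(r\in R)$, and put $\sigma^{\alpha}=\sigma_1^{\alpha_1}\circ\dots\circ\sigma_n^{\alpha_n}$, $\delta^{\beta}=\delta_1^{\beta_1}\circ\dots\circ\delta_n^{\beta_n}$. Assume that $A$ is bijective, i.e. every $\sigma_i$ is bijective and $d_{i,j}$ is invertible for $i<j$. $A$ is called quantized if there are central invertible elements $q_1,\dots,q_n\in R$ with $\delta_i\sigma_i=q_i\sigma_i\delta_i$, $\sigma_i(q_j)=q_j$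 and $\delta_i(q_j)=0$ for all $1\le i,j\le n$. For $I\subseteq R$ put $$I_{\Delta}=\{a\in I:\delta^{\beta}(a)\in I\ \text{for all}\ \beta\in\mathbb N^n\},\qquad I_{\Sigma,\Delta}=\{a\in I:\sigma^{\alpha}\delta^{\beta}(a)\in I\ \text{for all}\ \alpha,\beta\in\mathbb N^n\},$$ and let $I\langle X\rangle\subseteq A$ be the set of all $\sum_\alpha a_{\alpha}x^{\alpha}$ with all $a_\alpha\in I$. $I$ is $(\Sigma,\Sigma^{-1})$-stable if $\sigma_i(I)=I$ for all $i$, and $(\Sigma,\Sigma^{-1},\Delta)$-stable if moreover $\delta_i(I)\subseteq I$ for all $i$. A right module $N$ over a ring $S$ is prime if $N\neq0$ and ${\rm ann}_S(N')={\rm ann}_S(N)$ for every nonzero submodule $N'\subseteq N$. ${\rm Ass}(N)$ is the set of prime ideals of $S$ of the form ${\rm ann}_S(N')$ with $N'\subseteq N$ a prime submodule. For a right $R$-module $M$ let $M\langle X\rangle_A=M\otimes_RA$ be the induced right $A$-module; its elements are written uniquely as finite sums $\sum_\alpha m_{\alpha}x^{\alpha}$ with $m_\alpha\in M$. Fix a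 monomial order $\preceq$ on the monomials $x^\alpha$ (a total order, compatible with addition of exponents, with smallest element $1$) which is degree compatible ($|\alpha|<|\beta|$ implies $x^{\alpha}\prec x^{\beta}$), and let ${\rm lm}$ denote the leading monomial. A nonzero $m\in M\langle X\rangle$ is a good polynomial if ${\rm lm}(mr)={\rm lm}(m)$ for every $r\in R$ with $mr\ne0$. The module $M\langle X\rangle_A$ is good if for every good polynomial $m\in M\langle X\rangle$ with ${\rm lm}(m)=x^{\alpha}$ and every $\beta\in\alpha+\mathbb N^n$ there is a good polynomial $f\in mA$ with ${\rm lm}(f)=x^{\beta}$. **Theorem.** Let $M_R$ be a prime module and $P={\rm ann}_R(M)$. 1. If $P$ is $(\Sigma,\Sigma^{-1},\Delta)$-stable, then $M\langle X\rangle_A$ is prime, and its associated prime ideal is $Q=P\langle X\rangle$, i.e. ${\rm ann}_A(M\langle X\rangle)=Q$ and ${\rm Ass}(M\langle X\rangle_A)=\{Q\}$. 2. If $A$ is quantized and $P$ is $(\Sigma,\Sigma^{-1})$-stable, then $M\langle X\rangle_A$ is prime with associated prime ideal (in the same sense) $Q=P_{\Delta}\langle X\rangle$. 3. If $A$ is quantized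 and $M\langle X\rangle_A$ is good, then $M\langle X\rangle_A$ is prime if and only if $P_{\Sigma,\Delta}$ is $(\Sigma,\Sigma^{-1})$-stable; and if $M\langle X\rangle_A$ is prime, then its associated prime ideal is $Q=P_{\Sigma,\Delta}\langle X\rangle$. -/

import Mathlib

noncomputable section

open MulOpposite

namespace SkewPBW

/-! ### Skew PBW extensions -/

/-- The standard monomial `x₁ ^ α₁ * ⋯ * xₙ ^ αₙ` (factors in this order). -/
def mon {A : Type*} [Ring A] {n : ℕ} (x : Fin n → A) (α : Fin n →₀ ℕ) : A :=
  (List.ofFn fun i => x i ^ α i).prod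

/-- `A` is a skew PBW extension over its subring `R` in the variables `x₁, …, xₙ`,
i.e. `A = σ(R)⟨x₁, …, xₙ⟩`. -/
structure IsSkewPBWExtension {A : Type*} [Ring A] (R : Subring A) {n : ℕ} (x : Fin n → A) :
    Prop where
  /-- The standard monomials are left linearly independent over `R`. -/
  linearIndependent : LinearIndependent R (mon x)
  /-- The standard monomials span `A` as a left `R`-module. -/
  span_eq_top : Submodule.span R (Set.range (mon x)) = ⊤
  /-- `xᵢ r - c xᵢ ∈ R` for some nonzero `c ∈ R`, for every nonzero `r ∈ R`. -/
  exists_c : ∀ (i : Fin n) (r : R), r ≠ 0 → ∃ c : R, c ≠ 0 ∧ x i * (r : A) - (c : A) * x i ∈ R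
  /-- `xⱼ xᵢ - d xᵢ xⱼ ∈ R + R x₁ + ⋯ + R xₙ` for some nonzero `d ∈ R`. -/
  exists_d : ∀ i j : Fin n, ∃ d : R, d ≠ 0 ∧ ∃ (r₀ : R) (r : Fin n → R),
    x j * x i - (d : A) * (x i * x j) = (r₀ : A) + ∑ k, (r k : A) * x k

namespace IsSkewPBWExtension

variable {A : Type*} [Ring A] {R : Subring A} {n : ℕ} {x : Fin n → A}

/-- The left `R`-basis of `A` consisting of the standard monomials. -/
def basis (h : IsSkewPBWExtension R x) : Module.Basis (Fin n →₀ ℕ) R A :=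
  Module.Basis.mk h.linearIndependent h.span_eq_top.ge

/-- The coefficient of `x ^ α` in `a ∈ A`. -/
def coeff (h : IsSkewPBWExtension R x) (a : A) (α : Fin n →₀ ℕ) : R := h.basis.repr a α

/-- The map `σᵢ : R → R` of the extension: `σᵢ(r)` is the coefficient of `xᵢ` in `xᵢ r`. -/
def sigma (h : IsSkewPBWExtension R x) (i : Fin n) (r : R) : R :=
  h.coeff (x i * (r : A)) (Finsupp.single i 1)

/-- The map `δᵢ : R → R` of the extension: `δᵢ(r)` is the constant coefficient of `xᵢ r`. -/
def delta (h : IsSkewPBWExtension R x) (i : Fin n) (r : R) : R :=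
  h.coeff (x i * (r : A)) 0

/-- A skew PBW extension is bijective if every `σᵢ` is bijective and, for `i < j`, the coefficient
`d_{i,j}` of `xᵢ xⱼ` in `xⱼ xᵢ` is invertible. -/
def IsBijective (h : IsSkewPBWExtension R x) : Prop :=
  (∀ i, Function.Bijective (h.sigma i)) ∧
  ∀ i j, i < j → IsUnit (h.coeff (x j * x i) (Finsupp.single i 1 + Finsupp.single j 1))

/-- A skew PBW extension is quantized if there are central units `q₁, …, qₙ` of `R` with
`δᵢ σᵢ = qᵢ σᵢ δᵢ`, `σᵢ(qⱼ) = qⱼ` and `δᵢ(qⱼ) = 0`. -/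
def IsQuantized (h : IsSkewPBWExtension R x) : Prop :=
  ∃ q : Fin n → R, (∀ i, q i ∈ Subring.center R ∧ IsUnit (q i)) ∧
    (∀ i r, h.delta i (h.sigma i r) = q i * h.sigma i (h.delta i r)) ∧
    ∀ i j, h.sigma i (q j) = q j ∧ h.delta i (q j) = 0

/-! ### Facts showing that the maps above are the usual ones -/

theorem basis_apply (h : IsSkewPBWExtension R x) (α : Fin n →₀ ℕ) : h.basis α = mon x α := by
  simp [basis]

theorem _root_.SkewPBW.mon_zero (x : Fin n → A) : mon x 0 = 1 := by
  simp [mon]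

theorem _root_.SkewPBW.mon_single (x : Fin n → A) (i : Fin n) :
    mon x (Finsupp.single i 1) = x i := by
  have key : ∀ (m : ℕ) (y : Fin m → A) (i : Fin m),
      (List.ofFn fun k => y k ^ (Finsupp.single i 1 : Fin m →₀ ℕ) k).prod = y i := by
    intro m
    induction m with
    | zero => intro y i; exact i.elim0
    | succ m ih =>
      intro y i
      rw [List.ofFn_succ, List.prod_cons]
      refine Fin.cases ?_ (fun j => ?_) i
      · have : ∀ k : Fin m, (Finsupp.single (0 : Fin (m + 1)) 1 : Fin (m + 1) →₀ ℕ) k.succ = 0 :=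
          fun k => Finsupp.single_eq_of_ne (Fin.succ_ne_zero k)
        simp [this]
      · have h0 : (Finsupp.single j.succ 1 : Fin (m + 1) →₀ ℕ) 0 = 0 :=
          Finsupp.single_eq_of_ne (Fin.succ_ne_zero j).symm
        have hs : ∀ k : Fin m, (Finsupp.single j.succ 1 : Fin (m + 1) →₀ ℕ) k.succ
            = (Finsupp.single j 1 : Fin m →₀ ℕ) k := by
          intro k
          simp [Finsupp.single_apply]
        simp only [h0, pow_zero, one_mul, hs]
        exact ih (fun k => y k.succ) j
  exact key n x i

/-- The defining relation `xᵢ r = σᵢ(r) xᵢ + δᵢ(r)`. -/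
theorem x_mul_coe (h : IsSkewPBWExtension R x) (i : Fin n) (r : R) :
    x i * (r : A) = (h.sigma i r : A) * x i + (h.delta i r : A) := by
  obtain ⟨c, e, hce⟩ : ∃ c e : R, x i * (r : A) = (c : A) * x i + (e : A) := by
    by_cases hr : r = 0
    · exact ⟨0, 0, by simp [hr]⟩
    · obtain ⟨c, -, hc⟩ := h.exists_c i r hr
      exact ⟨c, ⟨_, hc⟩, by simp⟩
  have hrepr : h.basis.repr (x i * (r : A)) =
      Finsupp.single (Finsupp.single i 1) c + Finsupp.single 0 e := by
    have h1 : x i * (r : A) = c • h.basis (Finsupp.single i 1) + e • h.basis 0 := by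
      rw [basis_apply, basis_apply, mon_single, mon_zero, hce]
      simp [Subring.smul_def]
    rw [h1, map_add, map_smul, map_smul, Module.Basis.repr_self, Module.Basis.repr_self]
    simp
  have hne : (Finsupp.single i 1 : Fin n →₀ ℕ) ≠ 0 := by simp
  have hs : h.sigma i r = c := by
    simp [sigma, coeff, hrepr]
  have hd : h.delta i r = e := by
    simp [delta, coeff, hrepr]
  rw [hs, hd, hce]

/-! ### Sets attached to an ideal -/

/-- `σ ^ α = σ₁ ^ α₁ ∘ ⋯ ∘ σₙ ^ αₙ`. -/
def sigmaPow (h : IsSkewPBWExtension R x) (α : Fin n →₀ ℕ) : R → R :=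
  (List.ofFn fun i => (h.sigma i)^[α i]).foldr (· ∘ ·) id

/-- `δ ^ β = δ₁ ^ β₁ ∘ ⋯ ∘ δₙ ^ βₙ`. -/
def deltaPow (h : IsSkewPBWExtension R x) (β : Fin n →₀ ℕ) : R → R :=
  (List.ofFn fun i => (h.delta i)^[β i]).foldr (· ∘ ·) id

/-- `I_Δ = {a ∈ I | δ ^ β (a) ∈ I for all β}`. -/
def deltaPart (h : IsSkewPBWExtension R x) (I : Set R) : Set R :=
  {a | a ∈ I ∧ ∀ β, h.deltaPow β a ∈ I}

/-- `I_{Σ,Δ} = {a ∈ I | σ ^ α (δ ^ β (a)) ∈ I for all α, β}`. -/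
def sigmaDeltaPart (h : IsSkewPBWExtension R x) (I : Set R) : Set R :=
  {a | a ∈ I ∧ ∀ α β, h.sigmaPow α (h.deltaPow β a) ∈ I}

/-- `I` is `(Σ, Σ⁻¹)`-stable: `σᵢ(I) = I` for all `i`. -/
def IsSigmaStable (h : IsSkewPBWExtension R x) (I : Set R) : Prop :=
  ∀ i, h.sigma i '' I = I

/-- `I` is `(Σ, Σ⁻¹, Δ)`-stable: `σᵢ(I) = I` and `δᵢ(I) ⊆ I` for all `i`. -/
def IsSigmaDeltaStable (h : IsSkewPBWExtension R x) (I : Set R) : Prop :=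
  ∀ i, h.sigma i '' I = I ∧ h.delta i '' I ⊆ I

/-- `I⟨X⟩`: the elements of `A` all of whose coefficients lie in `I`. -/
def polySet (h : IsSkewPBWExtension R x) (I : Set R) : Set A :=
  {a | ∀ α, h.coeff a α ∈ I}

end IsSkewPBWExtension

/-! ### Right modules: annihilators, prime modules, associated primes

A right `S`-module is a `Module Sᵐᵒᵖ N`, with `n · s` written `op s • n`. -/

/-- The right annihilator `ann_S(N) = {s | N s = 0}`, a two-sided ideal of `S`. -/
def rightAnn (S : Type*) [Ring S] (N : Type*) [AddCommGroup N] [Module Sᵐᵒᵖ N] :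
    TwoSidedIdeal S :=
  TwoSidedIdeal.mk' {s | ∀ v : N, op s • v = 0}
    (fun v => by simp)
    (fun {a b} ha hb v => by simp [add_smul, ha v, hb v])
    (fun {a} ha v => by simp [ha v])
    (fun {a b} hb v => by rw [op_mul, mul_smul]; exact hb _)
    (fun {a b} ha v => by rw [op_mul, mul_smul, ha v, smul_zero])

/-- A right module is prime if it is nonzero and all its nonzero submodules have the same
annihilator as the module itself. -/
def IsPrimeModule (S : Type*) [Ring S] (N : Type*) [AddCommGroup N] [Module Sᵐᵒᵖ N] : Prop :=
  Nontrivial N ∧ ∀ N' : Submodule Sᵐᵒᵖ N, N' ≠ ⊥ → rightAnn S N = rightAnn S N'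

/-- Prime (two-sided) ideals of a noncommutative ring: `P ≠ S`, and `a S b ⊆ P` implies
`a ∈ P` or `b ∈ P`. -/
def IsPrimeIdeal {S : Type*} [Ring S] (P : TwoSidedIdeal S) : Prop :=
  (1 : S) ∉ P ∧ ∀ a b : S, (∀ s : S, a * s * b ∈ P) → a ∈ P ∨ b ∈ P

/-- The set `Ass(N)` of associated prime ideals of a right module. -/
def assPrimes (S : Type*) [Ring S] (N : Type*) [AddCommGroup N] [Module Sᵐᵒᵖ N] :
    Set (TwoSidedIdeal S) :=
  {P | IsPrimeIdeal P ∧ ∃ N' : Submodule Sᵐᵒᵖ N, IsPrimeModule S N' ∧ P = rightAnn S N'}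

/-! ### The induced module -/

section Induced

variable {A : Type*} [Ring A] {R : Subring A} {n : ℕ} {x : Fin n → A}

/-- The induced module `M⟨X⟩_A`: formal sums `∑ m_α x ^ α` with `m_α ∈ M`, where
`(m x ^ α) · a = ∑_β (m c_β) x ^ β` if `x ^ α a = ∑_β c_β x ^ β` in `A`. -/
def Induced (_h : IsSkewPBWExtension R x) (M : Type*) [AddCommGroup M] : Type _ :=
  (Fin n →₀ ℕ) →₀ M

variable (h : IsSkewPBWExtension R x) (M : Type*) [AddCommGroup M]

instance : AddCommGroup (Induced h M) := inferInstanceAs (AddCommGroup ((Fin n →₀ ℕ) →₀ M))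

variable {M} in
/-- The coefficients of an element of `M⟨X⟩`. -/
def Induced.toFinsupp (f : Induced h M) : (Fin n →₀ ℕ) →₀ M := f

variable [Module Rᵐᵒᵖ M]

/-- The element `∑_β (m c_β) x ^ β` of `M⟨X⟩` for `m ∈ M` and `c = ∑_β c_β x ^ β ∈ A`. -/
def Induced.tmul : M →+ A →+ Induced h M :=
  AddMonoidHom.mk' (fun m =>
    (Finsupp.mapRange.addMonoidHom
      (AddMonoidHom.mk' (fun r : R => op r • m) (fun r s => by simp [add_smul]))).comp
      h.basis.repr.toLinearMap.toAddMonoidHom)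
    (fun m m' => by ext c α; exact smul_add _ _ _)

variable {M}

/-- The right multiplication of `f ∈ M⟨X⟩` by `a ∈ A`. -/
def Induced.mulRight (f : Induced h M) (a : A) : Induced h M :=
  Finsupp.sum f fun α m => Induced.tmul h M m (mon x α * a)

theorem Induced.tmul_apply (m : M) (c : A) (α : Fin n →₀ ℕ) :
    Induced.toFinsupp h (Induced.tmul h M m c) α = op (h.coeff c α) • m := rfl

theorem Induced.tmul_smul (m : M) (r : R) (c : A) :
    Induced.tmul h M m (r • c) = Induced.tmul h M (op r • m) c := by
  refine Finsupp.ext fun α => ?_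
  change Induced.toFinsupp h _ α = Induced.toFinsupp h _ α
  rw [Induced.tmul_apply, Induced.tmul_apply, smul_smul, ← op_mul]
  simp [IsSkewPBWExtension.coeff]

theorem Induced.tmul_mon (m : M) (α : Fin n →₀ ℕ) :
    Induced.tmul h M m (mon x α) = Finsupp.single α m := by
  refine Finsupp.ext fun β => ?_
  change Induced.toFinsupp h _ β = _
  rw [Induced.tmul_apply, IsSkewPBWExtension.coeff, ← h.basis_apply, Module.Basis.repr_self]
  by_cases hab : α = β
  · simp [hab]
  · simp [Finsupp.single_eq_of_ne (Ne.symm hab)]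

theorem Induced.add_mulRight (f g : Induced h M) (a : A) :
    Induced.mulRight h (f + g) a = Induced.mulRight h f a + Induced.mulRight h g a :=
  Finsupp.sum_add_index' (by simp) (by simp)

theorem Induced.zero_mulRight (a : A) : Induced.mulRight h (0 : Induced h M) a = 0 :=
  Finsupp.sum_zero_index

theorem Induced.mulRight_add (f : Induced h M) (a b : A) :
    Induced.mulRight h f (a + b) = Induced.mulRight h f a + Induced.mulRight h f b := by
  simp only [Induced.mulRight, mul_add, map_add]
  exact Finsupp.sum_add

theorem Induced.mulRight_zero (f : Induced h M) : Induced.mulRight h f 0 = 0 := by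
  have := Induced.mulRight_add h f 0 0
  simpa using this

theorem Induced.single_mulRight (α : Fin n →₀ ℕ) (m : M) (a : A) :
    Induced.mulRight h (Finsupp.single α m) a = Induced.tmul h M m (mon x α * a) :=
  Finsupp.sum_single_index (by simp)

theorem Induced.tmul_mulRight (m : M) (c a : A) :
    Induced.mulRight h (Induced.tmul h M m c) a = Induced.tmul h M m (c * a) := by
  have hc : c ∈ Submodule.span R (Set.range (mon x)) := h.span_eq_top ▸ Submodule.mem_top
  induction hc using Submodule.span_induction generalizing m with
  | zero => simp [Induced.zero_mulRight]
  | mem u hu =>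
    obtain ⟨α, rfl⟩ := hu
    rw [Induced.tmul_mon, Induced.single_mulRight]
  | add u v _ _ hu hv => rw [map_add, Induced.add_mulRight, hu, hv, add_mul, map_add]
  | smul r u _ hu => rw [Induced.tmul_smul, hu, smul_mul_assoc, Induced.tmul_smul]

theorem Induced.mulRight_mul (f : Induced h M) (a b : A) :
    Induced.mulRight h f (a * b) = Induced.mulRight h (Induced.mulRight h f a) b := by
  induction f using Finsupp.induction_linear with
  | zero => exact (Induced.zero_mulRight h _).trans (by
      rw [show Induced.mulRight h (0 : (Fin n →₀ ℕ) →₀ M) a = 0 from Induced.zero_mulRight h a]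
      exact (Induced.zero_mulRight h _).symm)
  | add f g hf hg =>
    refine (Induced.add_mulRight h f g _).trans ?_
    rw [hf, hg, ← Induced.add_mulRight]
    exact congrArg (Induced.mulRight h · b) (Induced.add_mulRight h f g a).symm
  | single α m => rw [Induced.single_mulRight, Induced.single_mulRight, Induced.tmul_mulRight,
      mul_assoc]

theorem Induced.mulRight_one (f : Induced h M) : Induced.mulRight h f 1 = f := by
  simp only [Induced.mulRight, mul_one, Induced.tmul_mon]
  exact Finsupp.sum_single f

instance : Module Aᵐᵒᵖ (Induced h M) where
  smul a f := Induced.mulRight h f a.unop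
  one_smul f := Induced.mulRight_one h f
  mul_smul a b f := Induced.mulRight_mul h f b.unop a.unop
  smul_zero a := Induced.zero_mulRight h a.unop
  smul_add a f g := Induced.add_mulRight h f g a.unop
  add_smul a b f := Induced.mulRight_add h f a.unop b.unop
  zero_smul f := Induced.mulRight_zero h f

/-! ### Good polynomials and good induced modules -/

/-- A monomial order is degree compatible if monomials of smaller total degree are smaller. -/
def DegreeCompatible (ord : MonomialOrder (Fin n)) : Prop :=
  ∀ α β : Fin n →₀ ℕ, α.degree < β.degree → ord.toSyn α < ord.toSyn β

/-- The exponent of the leading monomial `lm(f)` of a nonzero `f ∈ M⟨X⟩`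
(used only for nonzero `f`). -/
def leadExp (ord : MonomialOrder (Fin n)) (f : Induced h M) : Fin n →₀ ℕ :=
  ord.toSyn.symm ((Induced.toFinsupp h f).support.sup fun α => ord.toSyn α)

/-- A nonzero `f ∈ M⟨X⟩` is a good polynomial if `lm(f r) = lm(f)` for all `r ∈ R` with
`f r ≠ 0`. -/
def IsGoodPoly (ord : MonomialOrder (Fin n)) (f : Induced h M) : Prop :=
  f ≠ 0 ∧ ∀ r : R, op (r : A) • f ≠ 0 → leadExp h ord (op (r : A) • f) = leadExp h ord f

variable (M) in
/-- `M⟨X⟩_A` is good if for every good polynomial `f ∈ M⟨X⟩` and every monomial `x ^ β` that is a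
multiple of `lm(f)` (componentwise inequality of exponents) the submodule `f A` contains a good
polynomial with leading monomial `x ^ β`. -/
def IsGoodModule (ord : MonomialOrder (Fin n)) : Prop :=
  ∀ f : Induced h M, IsGoodPoly h ord f → ∀ β : Fin n →₀ ℕ, leadExp h ord f ≤ β →
    ∃ g ∈ Submodule.span Aᵐᵒᵖ {f}, IsGoodPoly h ord g ∧ leadExp h ord g = β

end Induced

end SkewPBW

end

/-!
Since `A` is bijective, `x ^ α r x ^ β = σ ^ α (r) u x ^ (α + β) +` (terms of smaller total degree)
with a unit `u` (`IsBijective.exists_mon_mul_coe_mul_mon`), so leading terms of products in `M⟨X⟩`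
are under control for every degree compatible order.

*Bounding annihilators from above.* An element of smallest leading exponent in a nonzero submodule
is a good polynomial (`exists_isGoodPoly_mem`). If `g` is good with leading exponent `α`, then
`g R s = 0` if and only if `σ ^ α (s) ∈ P`. Given `g R a = 0`, the coefficients of `a` in
`σ ^ (-α) (P)` may therefore be dropped, and the leading term of the rest shows, by primeness of
`M`, that nothing remains: all coefficients of `a` lie in `σ ^ (-α) (P)`
(`IsGoodPoly.sigmaPow_coeff_mem`).

*Improving the bound by derivations.* Let `V` be an ideal of `R` with `σᵢ(V) ⊆ V`. For
`a ∈ V⟨X⟩` one has `xᵢ a ∈ V⟨X⟩` if and only if `δᵢ` maps the coefficients of `a` into `V`. Hence a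
left ideal of `A` inside `V⟨X⟩` lies in `V_Δ⟨X⟩` (`IsSigmaInvariantIdeal.subset_polySet_deltaPart`).
Here `V_Δ` is treated as the intersection of the layers `V_k` of elements that all words of length
`< k` in the `δᵢ` map into `V`. The relations between the `σᵢ` and `δⱼ` obtained from `xⱼ xᵢ r`,
together with the quantization for `i = j`, show that each layer is again a `Σ`-invariant ideal
and that words may be reordered up to units and lower layers
(`IsSigmaInvariantIdeal.deltaLayer`, `IsSigmaInvariantIdeal.mem_deltaPart_iff`).

*Conclusion.* If `J ⊆ P` is an ideal stable under all `σᵢ` and `δᵢ`, then `J⟨X⟩` annihilates `M⟨X⟩`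
(`polySet_subset_rightAnn`). For `Σ`-stable `P` the two bounds match with `J = P_Δ` (which is `P`
itself if `P` is `Δ`-stable). In general put `P_Σ = {r | σ ^ α (r) ∈ P for all α}`, so that
`J = P_{Σ,Δ} = (P_Σ)_Δ`. If `M⟨X⟩` is good and `g` is a good polynomial with leading exponent `α`,
the annihilator of `g A` is bounded above by `σ ^ (-α) (J)⟨X⟩`
(`sigmaPow_coeff_mem_of_isGoodModule`), and for `α = eᵢ` it contains `σᵢ⁻¹ (J)`
(`coe_mem_rightAnn_span`). So the annihilators of all nonzero submodules agree precisely when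
`σᵢ⁻¹ (J) = J` for all `i`, and `α = 0` gives the annihilator of `M⟨X⟩`.
-/

noncomputable section

open MulOpposite

namespace SkewPBW

/-! ### Exponents and ordered products -/

/-- Induction on exponents which adds one at a position that precedes the whole support; this is
the recursion followed by the ordered products `x ^ α`, `σ ^ α` and `δ ^ α`. -/
theorem exponent_induction {n : ℕ} {p : (Fin n →₀ ℕ) → Prop} (zero : p 0)
    (step : ∀ (α : Fin n →₀ ℕ) (j : Fin n), (∀ k < j, α k = 0) → p α →
      p (α + Finsupp.single j 1)) (α : Fin n →₀ ℕ) : p α := by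
  induction hd : α.degree generalizing α with
  | zero =>
    rw [Finsupp.degree_eq_zero_iff] at hd
    exact hd ▸ zero
  | succ d ih =>
    have hne : α.support.Nonempty := by
      rw [Finsupp.support_nonempty_iff]
      rintro rfl
      simp at hd
    set j := α.support.min' hne with hj
    have hjm : α j ≠ 0 := Finsupp.mem_support_iff.1 (Finset.min'_mem _ hne)
    have hlt : ∀ k < j, α k = 0 := fun k hk => by
      by_contra hk0
      exact absurd (Finset.min'_le _ k (Finsupp.mem_support_iff.2 hk0)) (not_le.2 hk)
    have hle : Finsupp.single j 1 ≤ α := by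
      rw [Finsupp.single_le_iff]
      omega
    have heq : α - Finsupp.single j 1 + Finsupp.single j 1 = α := tsub_add_cancel_of_le hle
    rw [← heq]
    refine step _ _ (fun k hk => by simp [hlt k hk]) (ih _ ?_)
    have := congrArg Finsupp.degree heq
    rw [map_add, Finsupp.degree_single, hd] at this
    omega

theorem mon_add_single {A : Type*} [Ring A] {n : ℕ} (x : Fin n → A) {α : Fin n →₀ ℕ} {j : Fin n}
    (hj : ∀ k < j, α k = 0) : mon x (α + Finsupp.single j 1) = x j * mon x α := by
  have key : ∀ (m : ℕ) (y : Fin m → A) (β : Fin m → ℕ) (i : Fin m), (∀ k < i, β k = 0) →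
      (List.ofFn fun k => y k ^ (β k + if i = k then 1 else 0)).prod
        = y i * (List.ofFn fun k => y k ^ β k).prod := by
    intro m
    induction m with
    | zero => intro y β i; exact i.elim0
    | succ m ih =>
      intro y β i hi
      rw [List.ofFn_succ, List.prod_cons, List.ofFn_succ, List.prod_cons]
      induction i using Fin.cases with
      | zero => simp [(Fin.succ_ne_zero _).symm, pow_succ', mul_assoc]
      | succ i =>
        have h0 : β 0 = 0 := hi 0 (Fin.succ_pos i)
        have := ih (fun k => y k.succ) (fun k => β k.succ) i
          (fun k hk => hi _ (Fin.succ_lt_succ_iff.2 hk))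
        simpa [h0, Fin.succ_ne_zero] using this
  simpa [mon, Finsupp.single_apply] using key n x α j hj

theorem foldr_comp_iterate_add_single {X : Type*} {n : ℕ} (f : Fin n → X → X)
    {α : Fin n →₀ ℕ} {j : Fin n} (hj : ∀ k < j, α k = 0) (r : X) :
    (List.ofFn fun i => (f i)^[(α + Finsupp.single j 1 : Fin n →₀ ℕ) i]).foldr (· ∘ ·) id r
      = f j ((List.ofFn fun i => (f i)^[α i]).foldr (· ∘ ·) id r) := by
  have key : ∀ (m : ℕ) (g : Fin m → X → X) (β : Fin m → ℕ) (i : Fin m), (∀ k < i, β k = 0) →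
      (List.ofFn fun k => (g k)^[β k + if i = k then 1 else 0]).foldr (· ∘ ·) id r
        = g i ((List.ofFn fun k => (g k)^[β k]).foldr (· ∘ ·) id r) := by
    intro m
    induction m with
    | zero => intro y β i; exact i.elim0
    | succ m ih =>
      intro g β i hi
      rw [List.ofFn_succ, List.foldr_cons, List.ofFn_succ, List.foldr_cons]
      induction i using Fin.cases with
      | zero =>
        simp only [(Fin.succ_ne_zero _).symm, if_true, if_false, add_zero,
          Function.iterate_succ', Function.comp_apply]
      | succ i =>
        have h0 : β 0 = 0 := hi 0 (Fin.succ_pos i)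
        have := ih (fun k => g k.succ) (fun k => β k.succ) i
          (fun k hk => hi _ (Fin.succ_lt_succ_iff.2 hk))
        simpa [h0, Fin.succ_ne_zero] using this
  simpa [Finsupp.single_apply] using key n f α j hj

namespace IsSkewPBWExtension

variable {A : Type*} [Ring A] {R : Subring A} {n : ℕ} {x : Fin n → A}
  (h : IsSkewPBWExtension R x)

/-! ### Coefficients -/

theorem coeff_zero (α : Fin n →₀ ℕ) : h.coeff 0 α = 0 := by simp [coeff]

theorem coeff_add (a b : A) (α : Fin n →₀ ℕ) :
    h.coeff (a + b) α = h.coeff a α + h.coeff b α := by simp [coeff]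

theorem coeff_sub (a b : A) (α : Fin n →₀ ℕ) :
    h.coeff (a - b) α = h.coeff a α - h.coeff b α := by simp [coeff]

theorem coeff_coe_mul (r : R) (a : A) (α : Fin n →₀ ℕ) :
    h.coeff ((r : A) * a) α = r * h.coeff a α := by
  change h.coeff (r • a) α = _
  simp [coeff]

theorem coeff_sum {ι : Type*} (s : Finset ι) (f : ι → A) (α : Fin n →₀ ℕ) :
    h.coeff (∑ i ∈ s, f i) α = ∑ i ∈ s, h.coeff (f i) α := by
  simp [coeff, Finsupp.finsetSum_apply]

theorem coeff_mon (α β : Fin n →₀ ℕ) : h.coeff (mon x α) β = if α = β then 1 else 0 := by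
  rw [coeff, ← h.basis_apply, Module.Basis.repr_self, Finsupp.single_apply]

theorem coeff_x (i : Fin n) (β : Fin n →₀ ℕ) :
    h.coeff (x i) β = if Finsupp.single i 1 = β then 1 else 0 := by
  rw [← mon_single x i, coeff_mon]

theorem coeff_coe (r : R) (β : Fin n →₀ ℕ) : h.coeff (r : A) β = if 0 = β then r else 0 := by
  have := h.coeff_coe_mul r 1 β
  rw [mul_one] at this
  rw [this, ← mon_zero x, coeff_mon]
  simp

theorem eq_sum_coeff (a : A) :
    a = ∑ α ∈ (h.basis.repr a).support, (h.coeff a α : A) * mon x α := by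
  conv_lhs => rw [← h.basis.linearCombination_repr a, Finsupp.linearCombination_apply, Finsupp.sum]
  simp [Subring.smul_def, coeff, basis_apply]

/-- A linear polynomial `e₀ + ∑ eₖ xₖ` vanishes only if all its coefficients do. -/
theorem linear_eq_zero (h : IsSkewPBWExtension R x) {e₀ : R} {e : Fin n → R}
    (H : (e₀ : A) + ∑ k, (e k : A) * x k = 0) :
    e₀ = 0 ∧ ∀ k, e k = 0 := by
  constructor
  · have := congrArg (h.coeff · 0) H
    simpa [coeff_add, coeff_sum, coeff_coe, coeff_coe_mul, coeff_x, coeff_zero] using this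
  · intro k
    have := congrArg (h.coeff · (Finsupp.single k 1)) H
    have hk : (0 : Fin n →₀ ℕ) ≠ Finsupp.single k 1 := by simp [eq_comm]
    simpa [coeff_add, coeff_sum, coeff_coe, coeff_coe_mul, coeff_x, coeff_zero, hk,
      Finsupp.single_left_inj] using this

/-! ### The maps `σᵢ` and `δᵢ` -/

theorem sigma_delta_eq {i : Fin n} {r c e : R}
    (H : x i * (r : A) = (c : A) * x i + (e : A)) : h.sigma i r = c ∧ h.delta i r = e := by
  have hk : (0 : Fin n →₀ ℕ) ≠ Finsupp.single i 1 := by simp [eq_comm]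
  constructor
  · simp [sigma, H, coeff_add, coeff_coe_mul, coeff_x, coeff_coe, hk]
  · simp [delta, H, coeff_add, coeff_coe_mul, coeff_x, coeff_coe]

theorem sigma_one_delta_one (i : Fin n) : h.sigma i 1 = 1 ∧ h.delta i 1 = 0 :=
  h.sigma_delta_eq (by simp)

theorem sigma_delta_add (i : Fin n) (r s : R) :
    h.sigma i (r + s) = h.sigma i r + h.sigma i s ∧
      h.delta i (r + s) = h.delta i r + h.delta i s := by
  simp [sigma, delta, mul_add, coeff_add]

theorem sigma_delta_mul (i : Fin n) (r s : R) :
    h.sigma i (r * s) = h.sigma i r * h.sigma i s ∧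
      h.delta i (r * s) = h.sigma i r * h.delta i s + h.delta i r * s := by
  apply h.sigma_delta_eq
  push_cast
  rw [← mul_assoc, x_mul_coe h, add_mul, mul_assoc, x_mul_coe h]
  noncomm_ring

/-- The endomorphism `σᵢ` of `R`, as a ring homomorphism. -/
def sigmaHom (i : Fin n) : R →+* R where
  toFun := h.sigma i
  map_one' := (h.sigma_one_delta_one i).1
  map_mul' r s := (h.sigma_delta_mul i r s).1
  map_zero' := by simp [sigma, coeff_zero]
  map_add' r s := (h.sigma_delta_add i r s).1

theorem sigma_mul (i : Fin n) (r s : R) : h.sigma i (r * s) = h.sigma i r * h.sigma i s :=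
  map_mul (h.sigmaHom i) r s

theorem sigma_add (i : Fin n) (r s : R) : h.sigma i (r + s) = h.sigma i r + h.sigma i s :=
  map_add (h.sigmaHom i) r s

theorem sigma_zero (i : Fin n) : h.sigma i 0 = 0 := map_zero (h.sigmaHom i)

theorem isUnit_sigma (i : Fin n) {u : R} (hu : IsUnit u) : IsUnit (h.sigma i u) :=
  hu.map (h.sigmaHom i)

theorem delta_zero (i : Fin n) : h.delta i 0 = 0 := by simp [delta, coeff_zero]

theorem delta_add (i : Fin n) (r s : R) : h.delta i (r + s) = h.delta i r + h.delta i s :=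
  (h.sigma_delta_add i r s).2

theorem delta_mul (i : Fin n) (r s : R) :
    h.delta i (r * s) = h.sigma i r * h.delta i s + h.delta i r * s :=
  (h.sigma_delta_mul i r s).2

theorem sigmaPow_zero (r : R) : h.sigmaPow 0 r = r := by
  have : ∀ m : ℕ, (List.replicate m (id : R → R)).foldr (· ∘ ·) id = id := by
    intro m
    induction m with
    | zero => rfl
    | succ m ih => simp [List.replicate_succ, ih]
  simp [sigmaPow, this]

theorem deltaPow_zero (r : R) : h.deltaPow 0 r = r := by
  have : ∀ m : ℕ, (List.replicate m (id : R → R)).foldr (· ∘ ·) id = id := by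
    intro m
    induction m with
    | zero => rfl
    | succ m ih => simp [List.replicate_succ, ih]
  simp [deltaPow, this]

theorem sigmaPow_add_single {α : Fin n →₀ ℕ} {j : Fin n} (hj : ∀ k < j, α k = 0) (r : R) :
    h.sigmaPow (α + Finsupp.single j 1) r = h.sigma j (h.sigmaPow α r) :=
  foldr_comp_iterate_add_single h.sigma hj r

theorem deltaPow_add_single {α : Fin n →₀ ℕ} {j : Fin n} (hj : ∀ k < j, α k = 0) (r : R) :
    h.deltaPow (α + Finsupp.single j 1) r = h.delta j (h.deltaPow α r) :=
  foldr_comp_iterate_add_single h.delta hj r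

theorem sigmaPow_single (i : Fin n) (r : R) :
    h.sigmaPow (Finsupp.single i 1) r = h.sigma i r := by
  have := h.sigmaPow_add_single (α := 0) (j := i) (by simp) r
  rwa [zero_add, sigmaPow_zero] at this

theorem sigmaPow_mul (α : Fin n →₀ ℕ) (r s : R) :
    h.sigmaPow α (r * s) = h.sigmaPow α r * h.sigmaPow α s := by
  induction α using exponent_induction with
  | zero => simp [sigmaPow_zero]
  | step α j hj ih => simp only [h.sigmaPow_add_single hj, ih, sigma_mul]

theorem sigmaPow_add (α : Fin n →₀ ℕ) (r s : R) :
    h.sigmaPow α (r + s) = h.sigmaPow α r + h.sigmaPow α s := by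
  induction α using exponent_induction with
  | zero => simp [sigmaPow_zero]
  | step α j hj ih => simp only [h.sigmaPow_add_single hj, ih, sigma_add]

theorem sigmaPow_map_zero (α : Fin n →₀ ℕ) : h.sigmaPow α 0 = 0 := by
  induction α using exponent_induction with
  | zero => simp [sigmaPow_zero]
  | step α j hj ih => simp only [h.sigmaPow_add_single hj, ih, sigma_zero]

variable {h} in
theorem IsBijective.sigmaPow_surjective (hb : h.IsBijective) (α : Fin n →₀ ℕ) :
    Function.Surjective (h.sigmaPow α) := by
  induction α using exponent_induction with
  | zero => exact fun r => ⟨r, h.sigmaPow_zero r⟩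
  | step α j hj ih =>
    intro r
    obtain ⟨s, rfl⟩ := (hb.1 j).2 r
    obtain ⟨t, rfl⟩ := ih s
    exact ⟨t, h.sigmaPow_add_single hj t⟩

/-! ### The degree filtration -/

/-- The left `R`-submodule of `A` spanned by the standard monomials of total degree `< d`. -/
def lowDeg (d : ℕ) : Submodule R A where
  carrier := {a | ∀ α : Fin n →₀ ℕ, d ≤ α.degree → h.coeff a α = 0}
  add_mem' ha hb α hα := by rw [coeff_add, ha α hα, hb α hα, add_zero]
  zero_mem' α _ := h.coeff_zero α
  smul_mem' r a ha α hα := by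
    change h.coeff ((r : A) * a) α = 0
    rw [coeff_coe_mul, ha α hα, mul_zero]

variable {h}

theorem lowDeg_mono {d e : ℕ} (hde : d ≤ e) {a : A} (ha : a ∈ h.lowDeg d) : a ∈ h.lowDeg e :=
  fun α hα => ha α (hde.trans hα)

theorem coe_mul_mem_lowDeg {d : ℕ} (r : R) {a : A} (ha : a ∈ h.lowDeg d) :
    (r : A) * a ∈ h.lowDeg d :=
  (h.lowDeg d).smul_mem r ha

theorem mon_mem_lowDeg {d : ℕ} {α : Fin n →₀ ℕ} (hα : α.degree < d) : mon x α ∈ h.lowDeg d := by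
  intro β hβ
  rw [coeff_mon, if_neg]
  rintro rfl
  omega

theorem lowDeg_induction {d : ℕ} {p : A → Prop} (zero : p 0)
    (add : ∀ a b, p a → p b → p (a + b))
    (mon : ∀ (r : R) (α : Fin n →₀ ℕ), α.degree < d → p ((r : A) * mon x α))
    {a : A} (ha : a ∈ h.lowDeg d) : p a := by
  rw [h.eq_sum_coeff a]
  refine Finset.sum_induction _ p add zero fun α hα => mon _ _ ?_
  by_contra hd
  exact Finsupp.mem_support_iff.1 hα (ha α (not_lt.1 hd))

/-- Under bijectivity any two variables commute up to a unit and a linear polynomial, in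
whichever order they are taken. -/
theorem IsBijective.exists_x_mul_x (hb : h.IsBijective) (i j : Fin n) :
    ∃ (d e₀ : R) (e : Fin n → R), IsUnit d ∧
      x j * x i = (d : A) * (x i * x j) + ((e₀ : A) + ∑ k, (e k : A) * x k) := by
  have lt : ∀ i j : Fin n, i < j → ∃ (d e₀ : R) (e : Fin n → R), IsUnit d ∧
      x j * x i = (d : A) * (x i * x j) + ((e₀ : A) + ∑ k, (e k : A) * x k) := by
    intro i j hij
    obtain ⟨d, -, e₀, e, he⟩ := h.exists_d i j
    rw [sub_eq_iff_eq_add'] at he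
    refine ⟨d, e₀, e, ?_, he⟩
    have hu := hb.2 i j hij
    have hm : x i * x j = mon x (Finsupp.single i 1 + Finsupp.single j 1) := by
      rw [add_comm, mon_add_single x (j := i), mon_single]
      intro k hk
      exact Finsupp.single_eq_of_ne (hk.trans hij).ne
    have hne : ∀ k, Finsupp.single k 1 ≠ Finsupp.single i 1 + Finsupp.single j 1 := by
      intro k hk
      simpa using congrArg Finsupp.degree hk
    have h0 : (0 : Fin n →₀ ℕ) ≠ Finsupp.single i 1 + Finsupp.single j 1 := by
      intro hk
      simpa using congrArg Finsupp.degree hk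
    rw [he, hm] at hu
    simpa [coeff_add, coeff_sum, coeff_coe_mul, coeff_mon, coeff_x, coeff_coe, hne, h0] using hu
  rcases lt_trichotomy i j with hij | rfl | hij
  · exact lt i j hij
  · exact ⟨1, 0, 0, isUnit_one, by simp⟩
  · obtain ⟨d, e₀, e, ⟨u, rfl⟩, he⟩ := lt j i hij
    refine ⟨(↑u⁻¹ : R), -(↑u⁻¹ * e₀), fun k => -(↑u⁻¹ * e k), Units.isUnit _, ?_⟩
    have hu : ((↑u⁻¹ : R) : A) * ((u : R) : A) = 1 := by
      rw [← Subring.coe_mul, Units.inv_mul, Subring.coe_one]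
    rw [he]
    push_cast
    simp only [neg_mul, Finset.sum_neg_distrib, mul_add, ← mul_assoc, hu, one_mul, Finset.mul_sum]
    abel

/-- Multiplication by a variable raises the filtration degree by at most one as soon as it does
so on monomials. -/
theorem x_mul_mem_lowDeg_of_mon {d : ℕ} {i : Fin n}
    (H : ∀ α : Fin n →₀ ℕ, α.degree < d → x i * mon x α ∈ h.lowDeg (d + 1)) {a : A}
    (ha : a ∈ h.lowDeg d) : x i * a ∈ h.lowDeg (d + 1) := by
  refine lowDeg_induction (p := fun a => x i * a ∈ h.lowDeg (d + 1)) ?_ ?_ ?_ ha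
  · rw [mul_zero]; exact zero_mem _
  · intro a b ha hb; rw [mul_add]; exact add_mem ha hb
  · intro r α hα
    rw [← mul_assoc, x_mul_coe h, add_mul, mul_assoc]
    exact add_mem (coe_mul_mem_lowDeg _ (H α hα))
      (coe_mul_mem_lowDeg _ (mon_mem_lowDeg (by omega)))

/-- Reordering `xᵢ x ^ α` costs a unit and terms of degree at most `|α|`. -/
theorem IsBijective.x_mul_mon (hb : h.IsBijective) (α : Fin n →₀ ℕ) (i : Fin n) :
    ∃ u : R, IsUnit u ∧ x i * mon x α - (u : A) * mon x (α + Finsupp.single i 1) ∈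
      h.lowDeg (α.degree + 1) := by
  induction hD : α.degree using Nat.strong_induction_on generalizing α i with
  | _ D ih =>
    have hx : ∀ (i : Fin n) (d : ℕ), d ≤ D → ∀ a ∈ h.lowDeg d, x i * a ∈ h.lowDeg (d + 1) := by
      intro i d hd a ha
      refine x_mul_mem_lowDeg_of_mon (fun β hβ => ?_) ha
      obtain ⟨u, -, hu⟩ := ih β.degree (by omega) β i rfl
      rw [← sub_add_cancel (x i * mon x β) ((u : A) * mon x (β + Finsupp.single i 1))]
      exact add_mem (lowDeg_mono (by omega) hu)
        (coe_mul_mem_lowDeg _ (mon_mem_lowDeg (by simp; omega)))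
    induction α using exponent_induction with
    | zero => exact ⟨1, isUnit_one, by simp [mon_zero, mon_single]⟩
    | step α j hj _ =>
      rw [map_add, Finsupp.degree_single] at hD
      by_cases hij : i ≤ j
      · refine ⟨1, isUnit_one, ?_⟩
        rw [mon_add_single x (j := i)]
        · simp
        · intro k hk
          rw [Finsupp.add_apply, hj k (hk.trans_le hij),
            Finsupp.single_eq_of_ne (hk.trans_le hij).ne, add_zero]
      · obtain ⟨d, e₀, e, hd, he⟩ := hb.exists_x_mul_x j i
        obtain ⟨u, hu, hm⟩ := ih α.degree (by omega) α i rfl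
        refine ⟨d * h.sigma j u, hd.mul (h.isUnit_sigma j hu), ?_⟩
        have hji : ∀ k < j, (α + Finsupp.single i 1 : Fin n →₀ ℕ) k = 0 := by
          intro k hk
          rw [Finsupp.add_apply, hj k hk, Finsupp.single_eq_of_ne (hk.trans (not_le.1 hij)).ne,
            add_zero]
        have e1 : x i * mon x (α + Finsupp.single j 1)
            - ((d * h.sigma j u : R) : A) * mon x (α + Finsupp.single j 1 + Finsupp.single i 1)
            = (d : A) * (x j * (x i * mon x α - (u : A) * mon x (α + Finsupp.single i 1)))
              + (d : A) * ((h.delta j u : A) * mon x (α + Finsupp.single i 1))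
              + (e₀ : A) * mon x α + ∑ k, (e k : A) * (x k * mon x α) := by
          rw [add_right_comm, mon_add_single x hji, mon_add_single x hj, ← mul_assoc (x i), he,
            mul_sub, ← mul_assoc (x j) (u : A), x_mul_coe h]
          simp only [add_mul, Finset.sum_mul, mul_assoc]
          push_cast
          noncomm_ring
        rw [e1]
        refine add_mem (add_mem (add_mem ?_ ?_) ?_) (sum_mem fun k _ => ?_)
        · refine coe_mul_mem_lowDeg _ ?_
          exact lowDeg_mono (by omega) (hx j D le_rfl _ (lowDeg_mono (by omega) hm))
        · exact coe_mul_mem_lowDeg _ (coe_mul_mem_lowDeg _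
            (mon_mem_lowDeg (by rw [map_add, Finsupp.degree_single]; omega)))
        · exact coe_mul_mem_lowDeg _ (mon_mem_lowDeg (by omega))
        · exact coe_mul_mem_lowDeg _ (hx k D le_rfl _ (mon_mem_lowDeg (by omega)))

theorem IsBijective.x_mul_mem_lowDeg (hb : h.IsBijective) (i : Fin n) {d : ℕ} {a : A}
    (ha : a ∈ h.lowDeg d) : x i * a ∈ h.lowDeg (d + 1) := by
  refine x_mul_mem_lowDeg_of_mon (fun β hβ => ?_) ha
  obtain ⟨u, -, hu⟩ := hb.x_mul_mon β i
  rw [← sub_add_cancel (x i * mon x β) ((u : A) * mon x (β + Finsupp.single i 1))]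
  exact add_mem (lowDeg_mono (by omega) hu)
    (coe_mul_mem_lowDeg _ (mon_mem_lowDeg (by simp; omega)))

theorem IsBijective.mon_mul_coe (hb : h.IsBijective) (α : Fin n →₀ ℕ) (r : R) :
    mon x α * (r : A) - (h.sigmaPow α r : A) * mon x α ∈ h.lowDeg α.degree := by
  induction α using exponent_induction with
  | zero => simp [mon_zero, sigmaPow_zero]
  | step α j hj ih =>
    have e1 : mon x (α + Finsupp.single j 1) * (r : A)
        - (h.sigmaPow (α + Finsupp.single j 1) r : A) * mon x (α + Finsupp.single j 1)
        = x j * (mon x α * (r : A) - (h.sigmaPow α r : A) * mon x α)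
          + (h.delta j (h.sigmaPow α r) : A) * mon x α := by
      rw [mon_add_single x hj, h.sigmaPow_add_single hj, mul_sub, ← mul_assoc (x j) (Subtype.val _),
        x_mul_coe h]
      noncomm_ring
    rw [e1, map_add, Finsupp.degree_single]
    exact add_mem (hb.x_mul_mem_lowDeg j ih) (coe_mul_mem_lowDeg _ (mon_mem_lowDeg (by omega)))

theorem IsBijective.mon_mul_mon (hb : h.IsBijective) (α β : Fin n →₀ ℕ) :
    ∃ u : R, IsUnit u ∧ mon x α * mon x β - (u : A) * mon x (α + β) ∈
      h.lowDeg (α.degree + β.degree) := by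
  induction α using exponent_induction with
  | zero => exact ⟨1, isUnit_one, by simp [mon_zero]⟩
  | step α j hj ih =>
    obtain ⟨u, hu, hm⟩ := ih
    obtain ⟨v, hv, hm'⟩ := hb.x_mul_mon (α + β) j
    refine ⟨h.sigma j u * v, (h.isUnit_sigma j hu).mul hv, ?_⟩
    have e1 : mon x (α + Finsupp.single j 1) * mon x β
        - ((h.sigma j u * v : R) : A) * mon x (α + Finsupp.single j 1 + β)
        = x j * (mon x α * mon x β - (u : A) * mon x (α + β))
          + (h.sigma j u : A) *
            (x j * mon x (α + β) - (v : A) * mon x (α + β + Finsupp.single j 1))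
          + (h.delta j u : A) * mon x (α + β) := by
      rw [mon_add_single x hj, add_right_comm, mul_sub, ← mul_assoc (x j) (u : A), x_mul_coe h]
      push_cast
      noncomm_ring
    rw [e1, map_add, Finsupp.degree_single]
    rw [map_add] at hm'
    refine add_mem (add_mem ?_ (coe_mul_mem_lowDeg _ (lowDeg_mono (by omega) hm'))) ?_
    · exact lowDeg_mono (by omega) (hb.x_mul_mem_lowDeg j hm)
    · exact coe_mul_mem_lowDeg _ (mon_mem_lowDeg (by rw [map_add]; omega))

theorem IsBijective.mul_mon_mem_lowDeg (hb : h.IsBijective) (β : Fin n →₀ ℕ) {d : ℕ} {a : A}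
    (ha : a ∈ h.lowDeg d) : a * mon x β ∈ h.lowDeg (d + β.degree) := by
  refine lowDeg_induction (p := fun a => a * mon x β ∈ h.lowDeg (d + β.degree)) ?_ ?_ ?_ ha
  · rw [zero_mul]; exact zero_mem _
  · intro a b ha hb; rw [add_mul]; exact add_mem ha hb
  · intro r α hα
    obtain ⟨u, -, hu⟩ := hb.mon_mul_mon α β
    rw [mul_assoc, ← sub_add_cancel (mon x α * mon x β) ((u : A) * mon x (α + β))]
    exact coe_mul_mem_lowDeg _ (add_mem (lowDeg_mono (by omega) hu)
        (coe_mul_mem_lowDeg _ (mon_mem_lowDeg (by rw [map_add]; omega))))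

/-- The leading term of `x ^ α r x ^ β` is `σ ^ α (r) u x ^ (α + β)` with a unit `u` that depends
only on `α` and `β`. -/
theorem IsBijective.exists_mon_mul_coe_mul_mon (hb : h.IsBijective) (α β : Fin n →₀ ℕ) :
    ∃ u : R, IsUnit u ∧ ∀ r : R,
      mon x α * ((r : A) * mon x β) - ((h.sigmaPow α r * u : R) : A) * mon x (α + β) ∈
        h.lowDeg (α.degree + β.degree) := by
  obtain ⟨u, hu, hm⟩ := hb.mon_mul_mon α β
  refine ⟨u, hu, fun r => ?_⟩
  have e1 : mon x α * ((r : A) * mon x β) - ((h.sigmaPow α r * u : R) : A) * mon x (α + β)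
      = (mon x α * (r : A) - (h.sigmaPow α r : A) * mon x α) * mon x β
        + (h.sigmaPow α r : A) * (mon x α * mon x β - (u : A) * mon x (α + β)) := by
    push_cast
    noncomm_ring
  rw [e1]
  exact add_mem (hb.mul_mon_mem_lowDeg β (hb.mon_mul_coe α r)) (coe_mul_mem_lowDeg _ hm)

theorem IsBijective.mon_mul_mem_lowDeg (hb : h.IsBijective) (α : Fin n →₀ ℕ) {d : ℕ} {a : A}
    (ha : a ∈ h.lowDeg d) : mon x α * a ∈ h.lowDeg (α.degree + d) := by
  induction α using exponent_induction with
  | zero => simpa [mon_zero] using ha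
  | step α j hj ih =>
    rw [mon_add_single x hj, mul_assoc, map_add, Finsupp.degree_single]
    exact lowDeg_mono (by omega) (hb.x_mul_mem_lowDeg j ih)

theorem IsBijective.mul_coe_mem_lowDeg (hb : h.IsBijective) (r : R) {d : ℕ} {a : A}
    (ha : a ∈ h.lowDeg d) : a * (r : A) ∈ h.lowDeg d := by
  refine lowDeg_induction (p := fun a => a * (r : A) ∈ h.lowDeg d) ?_ ?_ ?_ ha
  · rw [zero_mul]; exact zero_mem _
  · intro a b ha hb; rw [add_mul]; exact add_mem ha hb
  · intro s α hα
    rw [mul_assoc, ← sub_add_cancel (mon x α * (r : A)) ((h.sigmaPow α r : A) * mon x α)]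
    exact coe_mul_mem_lowDeg _ (add_mem (lowDeg_mono (by omega) (hb.mon_mul_coe α r))
      (coe_mul_mem_lowDeg _ (mon_mem_lowDeg hα)))

/-- The powers `σ ^ α` compose additively in `α` up to conjugation by a unit. -/
theorem IsBijective.exists_sigmaPow_sigmaPow (hb : h.IsBijective) (α β : Fin n →₀ ℕ) :
    ∃ u : R, IsUnit u ∧
      ∀ r, h.sigmaPow α (h.sigmaPow β r) * u = u * h.sigmaPow (α + β) r := by
  obtain ⟨u, hu, hm⟩ := hb.mon_mul_mon α β
  refine ⟨u, hu, fun r => ?_⟩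
  have e1 : ((h.sigmaPow α (h.sigmaPow β r) * u - u * h.sigmaPow (α + β) r : R) : A)
        * mon x (α + β)
      = (mon x α * mon x β - (u : A) * mon x (α + β)) * (r : A)
        + (u : A) * (mon x (α + β) * (r : A) - (h.sigmaPow (α + β) r : A) * mon x (α + β))
        - mon x α * (mon x β * (r : A) - (h.sigmaPow β r : A) * mon x β)
        - (mon x α * (h.sigmaPow β r : A) - (h.sigmaPow α (h.sigmaPow β r) : A) * mon x α)
          * mon x β
        - (h.sigmaPow α (h.sigmaPow β r) : A)
          * (mon x α * mon x β - (u : A) * mon x (α + β)) := by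
    push_cast
    noncomm_ring
  have hmem : ((h.sigmaPow α (h.sigmaPow β r) * u - u * h.sigmaPow (α + β) r : R) : A)
      * mon x (α + β) ∈ h.lowDeg (α.degree + β.degree) := by
    rw [e1]
    have e2 := hb.mon_mul_coe (α + β) r
    rw [map_add] at e2
    exact sub_mem (sub_mem (sub_mem (add_mem (hb.mul_coe_mem_lowDeg r hm)
      (coe_mul_mem_lowDeg _ e2)) (hb.mon_mul_mem_lowDeg α (hb.mon_mul_coe β r)))
      (hb.mul_mon_mem_lowDeg β (hb.mon_mul_coe α _))) (coe_mul_mem_lowDeg _ hm)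
  have := hmem (α + β) (by rw [map_add])
  rw [coeff_coe_mul, coeff_mon, if_pos rfl, mul_one] at this
  exact sub_eq_zero.1 this

/-! ### Commutation relations between the `σᵢ` and the `δᵢ` -/

/-- The relations obtained by comparing the coefficients of `xⱼ xᵢ r` computed in two ways. -/
theorem IsBijective.exists_commutation (hb : h.IsBijective) (i j : Fin n) :
    ∃ (d e₀ : R) (e : Fin n → R), IsUnit d ∧ ∀ r,
      h.sigma j (h.sigma i r) * d = d * h.sigma i (h.sigma j r) ∧
      h.delta j (h.delta i r) = d * h.delta i (h.delta j r) + e₀ * r + ∑ k, e k * h.delta k r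
        - h.sigma j (h.sigma i r) * e₀ ∧
      (i ≠ j → h.delta j (h.sigma i r) = d * h.sigma i (h.delta j r) + e i * h.sigma i r
        - h.sigma j (h.sigma i r) * e i) := by
  by_cases hij : i = j
  · subst hij
    exact ⟨1, 0, 0, isUnit_one, fun r => by simp⟩
  obtain ⟨d, e₀, e, hd, he⟩ := hb.exists_x_mul_x i j
  refine ⟨d, e₀, e, hd, fun r => ?_⟩
  set t : R := h.sigma j (h.sigma i r) * d - d * h.sigma i (h.sigma j r) with ht
  set c₀ : R := h.sigma j (h.sigma i r) * e₀ + h.delta j (h.delta i r)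
    - d * h.delta i (h.delta j r) - e₀ * r - ∑ k, e k * h.delta k r with hc₀
  set c : Fin n → R := fun k => h.sigma j (h.sigma i r) * e k - e k * h.sigma k r
    + Pi.single (M := fun _ => R) i
        (h.delta j (h.sigma i r) - d * h.sigma i (h.delta j r)) k
    + Pi.single (M := fun _ => R) j
        (h.sigma j (h.delta i r) - d * h.delta i (h.sigma j r)) k with hc
  have hsingle : ∀ (l : Fin n) (s : R),
      ∑ k, ((Pi.single (M := fun _ => R) l s k : R) : A) * x k = (s : A) * x l := by
    intro l s
    rw [Finset.sum_eq_single l]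
    · rw [Pi.single_eq_same]
    · intro k _ hk
      rw [Pi.single_eq_of_ne hk]
      simp
    · simp
  have key : (t : A) * (x i * x j) + ((c₀ : A) + ∑ k, (c k : A) * x k) = 0 := by
    have e1 : x j * x i * (r : A)
        = (h.sigma j (h.sigma i r) : A) * (x j * x i) + (h.delta j (h.sigma i r) : A) * x i
          + (h.sigma j (h.delta i r) : A) * x j + (h.delta j (h.delta i r) : A) := by
      rw [mul_assoc, x_mul_coe h, mul_add, ← mul_assoc, x_mul_coe h, x_mul_coe h]
      noncomm_ring
    have e2 : x j * x i * (r : A)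
        = (d : A) * ((h.sigma i (h.sigma j r) : A) * (x i * x j)
            + (h.delta i (h.sigma j r) : A) * x j
            + (h.sigma i (h.delta j r) : A) * x i + (h.delta i (h.delta j r) : A))
          + ((e₀ : A) * r + ∑ k, (e k : A) * ((h.sigma k r : A) * x k + (h.delta k r : A))) := by
      rw [he, add_mul, add_mul, Finset.sum_mul, mul_assoc, mul_assoc, x_mul_coe h j, mul_add,
        ← mul_assoc, x_mul_coe h, x_mul_coe h]
      simp only [mul_assoc, x_mul_coe h]
      noncomm_ring
    have e3 := e1.symm.trans e2
    rw [he] at e3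
    rw [← sub_eq_zero] at e3
    rw [← e3]
    simp only [ht, hc₀, hc]
    push_cast
    simp only [add_mul, sub_mul, Finset.sum_add_distrib, Finset.sum_sub_distrib, hsingle]
    push_cast
    simp only [mul_add, sub_mul, Finset.sum_add_distrib, Finset.mul_sum, mul_assoc]
    abel
  -- The coefficient of `xᵢ xⱼ` vanishes first, since that product has a unit leading coefficient
  -- even when it is not a standard monomial.
  have ht0 : t = 0 := by
    obtain ⟨u, hu, hm⟩ := hb.x_mul_mon (Finsupp.single j 1) i
    have h1 : x i * x j = (x i * mon x (Finsupp.single j 1)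
        - (u : A) * mon x (Finsupp.single j 1 + Finsupp.single i 1))
        + (u : A) * mon x (Finsupp.single j 1 + Finsupp.single i 1) := by
      rw [sub_add_cancel, mon_single]
    have h2 : h.coeff (x i * x j) (Finsupp.single j 1 + Finsupp.single i 1) = u := by
      rw [h1, coeff_add, hm _ (by simp), coeff_coe_mul, coeff_mon]
      simp
    have hne : ∀ k, Finsupp.single k 1 ≠ Finsupp.single j 1 + Finsupp.single i 1 := by
      intro k hk
      simpa using congrArg Finsupp.degree hk
    have h0 : (0 : Fin n →₀ ℕ) ≠ Finsupp.single j 1 + Finsupp.single i 1 := by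
      intro hk
      simpa using congrArg Finsupp.degree hk
    have := congrArg (h.coeff · (Finsupp.single j 1 + Finsupp.single i 1)) key
    simp only [coeff_add, coeff_sum, coeff_coe_mul, h2, coeff_x, coeff_coe, coeff_zero, if_neg h0,
      if_neg (hne _), mul_zero, Finset.sum_const_zero, add_zero] at this
    exact (hu.mul_left_eq_zero).1 this
  rw [ht0] at key
  obtain ⟨hz, hk⟩ := h.linear_eq_zero (by simpa using key)
  refine ⟨sub_eq_zero.1 ht0, ?_, fun _ => ?_⟩
  · rw [← sub_eq_zero, ← hz]
    simp only [hc₀]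
    abel
  · rw [← sub_eq_zero, ← hk i]
    simp only [hc, Pi.single_eq_same, Pi.single_eq_of_ne hij]
    abel

/-- In the quantized case the relation between `δⱼ` and `σᵢ` extends to `i = j`. -/
theorem IsBijective.exists_delta_sigma (hb : h.IsBijective) (hq : h.IsQuantized) (i j : Fin n) :
    ∃ d e : R, IsUnit d ∧ ∀ r, h.delta j (h.sigma i r)
      = d * h.sigma i (h.delta j r) + e * h.sigma i r - h.sigma j (h.sigma i r) * e := by
  by_cases hij : i = j
  · subst hij
    obtain ⟨q, hq1, hq2, -⟩ := hq
    exact ⟨q i, 0, (hq1 i).2, fun r => by simp [hq2]⟩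
  · obtain ⟨d, e₀, e, hd, he⟩ := hb.exists_commutation i j
    exact ⟨d, e i, hd, fun r => (he r).2.2 hij⟩

/-! ### `Σ`-invariant ideals and their `δ`-layers -/

variable (h) in
/-- `V` is (the underlying set of) a two-sided ideal of `R` with `σᵢ(V) ⊆ V` for all `i`. -/
structure IsSigmaInvariantIdeal (V : Set R) : Prop where
  zero_mem : (0 : R) ∈ V
  add_mem : ∀ {r s : R}, r ∈ V → s ∈ V → r + s ∈ V
  mul_mem_left : ∀ (r : R) {s : R}, s ∈ V → r * s ∈ V
  mul_mem_right : ∀ (r : R) {s : R}, s ∈ V → s * r ∈ V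
  sigma_mem : ∀ (i : Fin n) {r : R}, r ∈ V → h.sigma i r ∈ V

namespace IsSigmaInvariantIdeal

variable {V : Set R}

theorem sub_mem (hV : h.IsSigmaInvariantIdeal V) {r s : R} (hr : r ∈ V) (hs : s ∈ V) :
    r - s ∈ V := by
  have := hV.add_mem hr (hV.mul_mem_left (-1) hs)
  rwa [neg_one_mul, ← sub_eq_add_neg] at this

theorem sum_mem (hV : h.IsSigmaInvariantIdeal V) {ι : Type*} {s : Finset ι} {f : ι → R}
    (hf : ∀ i ∈ s, f i ∈ V) : ∑ i ∈ s, f i ∈ V :=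
  Finset.sum_induction f (· ∈ V) (fun _ _ => hV.add_mem) hV.zero_mem hf

theorem add_mem_iff_left (hV : h.IsSigmaInvariantIdeal V) {r s : R} (hs : s ∈ V) :
    r + s ∈ V ↔ r ∈ V :=
  ⟨fun H => by simpa using hV.sub_mem H hs, fun H => hV.add_mem H hs⟩

theorem unit_mul_mem_iff (hV : h.IsSigmaInvariantIdeal V) {u r : R} (hu : IsUnit u) :
    u * r ∈ V ↔ r ∈ V := by
  obtain ⟨u, rfl⟩ := hu
  exact ⟨fun H => by simpa using hV.mul_mem_left (↑u⁻¹) H, hV.mul_mem_left _⟩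

theorem preimage_sigma (hb : h.IsBijective) (hV : h.IsSigmaInvariantIdeal V) (i : Fin n) :
    h.IsSigmaInvariantIdeal (h.sigma i ⁻¹' V) where
  zero_mem := by simpa [sigma_zero] using hV.zero_mem
  add_mem hr hs := by
    simpa only [Set.mem_preimage, sigma_add] using hV.add_mem hr hs
  mul_mem_left r s hs := by
    simpa only [Set.mem_preimage, sigma_mul] using hV.mul_mem_left _ hs
  mul_mem_right r s hs := by
    simpa only [Set.mem_preimage, sigma_mul] using hV.mul_mem_right _ hs
  sigma_mem j r hr := by
    obtain ⟨d, e₀, e, hd, he⟩ := hb.exists_commutation i j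
    rw [Set.mem_preimage, ← hV.unit_mul_mem_iff hd, ← (he r).1]
    exact hV.mul_mem_right _ (hV.sigma_mem j hr)

theorem preimage_sigmaPow (hb : h.IsBijective) (hV : h.IsSigmaInvariantIdeal V)
    (α : Fin n →₀ ℕ) : h.IsSigmaInvariantIdeal (h.sigmaPow α ⁻¹' V) := by
  induction α using exponent_induction generalizing V with
  | zero =>
    convert hV
    ext
    simp [sigmaPow_zero]
  | step α j hj ih =>
    convert ih (hV.preimage_sigma hb j) using 1
    ext
    simp [h.sigmaPow_add_single hj]

end IsSigmaInvariantIdeal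

variable (h) in
/-- The elements of `R` that all words of length `< k` in the `δᵢ` map into `V`. -/
def deltaLayer (V : Set R) : ℕ → Set R
  | 0 => Set.univ
  | k + 1 => {r | r ∈ V ∧ ∀ i, h.delta i r ∈ deltaLayer V k}

theorem deltaLayer_succ_subset (V : Set R) (k : ℕ) :
    h.deltaLayer V (k + 1) ⊆ h.deltaLayer V k := by
  induction k with
  | zero => exact fun _ _ => Set.mem_univ _
  | succ k ih => exact fun r hr => ⟨hr.1, fun i => ih (hr.2 i)⟩

theorem deltaLayer_anti (V : Set R) : Antitone (h.deltaLayer V) :=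
  antitone_nat_of_succ_le (deltaLayer_succ_subset V)

namespace IsSigmaInvariantIdeal

variable {V : Set R}

/-- The layers of a `Σ`-invariant ideal are `Σ`-invariant ideals; this is where the quantization is
used. -/
theorem deltaLayer (hb : h.IsBijective) (hq : h.IsQuantized) (hV : h.IsSigmaInvariantIdeal V)
    (k : ℕ) : h.IsSigmaInvariantIdeal (h.deltaLayer V k) := by
  induction k with
  | zero => constructor <;> intros <;> exact Set.mem_univ _
  | succ k ih =>
    refine ⟨⟨hV.zero_mem, fun i => ?_⟩, fun hr hs => ⟨hV.add_mem hr.1 hs.1, fun i => ?_⟩,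
      fun r s hs => ⟨hV.mul_mem_left r hs.1, fun i => ?_⟩,
      fun r s hs => ⟨hV.mul_mem_right r hs.1, fun i => ?_⟩,
      fun i r hr => ⟨hV.sigma_mem i hr.1, fun j => ?_⟩⟩
    · rw [delta_zero]
      exact ih.zero_mem
    · rw [delta_add]
      exact ih.add_mem (hr.2 i) (hs.2 i)
    · rw [delta_mul]
      exact ih.add_mem (ih.mul_mem_left _ (hs.2 i))
        (ih.mul_mem_left _ (deltaLayer_succ_subset V k hs))
    · rw [delta_mul]
      exact ih.add_mem (ih.mul_mem_right _ (ih.sigma_mem i (deltaLayer_succ_subset V k hs)))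
        (ih.mul_mem_right _ (hs.2 i))
    · obtain ⟨d, e, -, he⟩ := hb.exists_delta_sigma hq i j
      have hr' := ih.sigma_mem i (deltaLayer_succ_subset V k hr)
      rw [he]
      exact ih.sub_mem (ih.add_mem (ih.mul_mem_left _ (ih.sigma_mem i (hr.2 j)))
        (ih.mul_mem_left _ hr')) (ih.mul_mem_right _ (ih.sigma_mem j hr'))

/-- Taking layers commutes with taking preimages under `σᵢ`. -/
theorem sigma_mem_deltaLayer_iff (hb : h.IsBijective) (hq : h.IsQuantized)
    (hV : h.IsSigmaInvariantIdeal V) (i : Fin n) (k : ℕ) (r : R) :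
    h.sigma i r ∈ h.deltaLayer V k ↔ r ∈ h.deltaLayer (h.sigma i ⁻¹' V) k := by
  induction k generalizing r with
  | zero => exact iff_of_true (Set.mem_univ _) (Set.mem_univ _)
  | succ k ih =>
    have hk := hV.deltaLayer hb hq k
    -- Modulo the `k`-th layer `δⱼ σᵢ` and `σᵢ δⱼ` agree up to a unit.
    have key : h.sigma i r ∈ h.deltaLayer V k → ∀ j,
        (h.delta j (h.sigma i r) ∈ h.deltaLayer V k ↔
          h.sigma i (h.delta j r) ∈ h.deltaLayer V k) := by
      intro hr j
      obtain ⟨d, e, hd, he⟩ := hb.exists_delta_sigma hq i j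
      rw [he, add_sub_assoc, hk.add_mem_iff_left, hk.unit_mul_mem_iff hd]
      exact hk.sub_mem (hk.mul_mem_left _ hr) (hk.mul_mem_right _ (hk.sigma_mem j hr))
    constructor
    · intro hr
      exact ⟨hr.1, fun j =>
        (ih _).1 ((key (deltaLayer_succ_subset V k hr) j).1 (hr.2 j))⟩
    · intro hr
      have hr' := (ih r).2 (deltaLayer_succ_subset _ k hr)
      exact ⟨hr.1, fun j => (key hr' j).2 ((ih _).2 (hr.2 j))⟩

theorem sigmaPow_mem_deltaLayer (hb : h.IsBijective) (hq : h.IsQuantized) (α : Fin n →₀ ℕ)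
    {V : Set R} (hV : h.IsSigmaInvariantIdeal V) {k : ℕ} {r : R}
    (hr : r ∈ h.deltaLayer (h.sigmaPow α ⁻¹' V) k) : h.sigmaPow α r ∈ h.deltaLayer V k := by
  induction α using exponent_induction generalizing V with
  | zero =>
    have : h.sigmaPow 0 ⁻¹' V = V := by ext; simp [sigmaPow_zero]
    rwa [this, ← h.sigmaPow_zero r] at hr
  | step α j hj ih =>
    rw [h.sigmaPow_add_single hj, hV.sigma_mem_deltaLayer_iff hb hq]
    refine ih (hV.preimage_sigma hb j) ?_
    convert hr using 2
    ext s
    simp [h.sigmaPow_add_single hj]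

end IsSigmaInvariantIdeal

/-! ### Words in the `δᵢ` -/

variable (h) in
/-- The composite of the `δᵢ` along a word, the first letter being applied first. -/
def deltaWord : List (Fin n) → R → R
  | [], r => r
  | i :: l, r => deltaWord l (h.delta i r)

theorem deltaWord_append (l l' : List (Fin n)) (r : R) :
    h.deltaWord (l ++ l') r = h.deltaWord l' (h.deltaWord l r) := by
  induction l generalizing r with
  | nil => rfl
  | cons i l ih => exact ih _

theorem deltaWord_add (l : List (Fin n)) (r s : R) :
    h.deltaWord l (r + s) = h.deltaWord l r + h.deltaWord l s := by
  induction l generalizing r s with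
  | nil => rfl
  | cons i l ih => simp only [deltaWord, delta_add, ih]

theorem deltaWord_mem_deltaLayer {V : Set R} {l : List (Fin n)} {k : ℕ} {r : R}
    (hr : r ∈ h.deltaLayer V (l.length + k)) : h.deltaWord l r ∈ h.deltaLayer V k := by
  induction l generalizing r with
  | nil => simpa [deltaWord] using hr
  | cons i l ih =>
    rw [List.length_cons, add_right_comm] at hr
    exact ih (hr.2 i)

theorem mem_deltaLayer_of_deltaWord (V : Set R) {k : ℕ} {r : R}
    (H : ∀ l : List (Fin n), l.length < k → h.deltaWord l r ∈ V) : r ∈ h.deltaLayer V k := by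
  induction k generalizing r with
  | zero => exact Set.mem_univ _
  | succ k ih =>
    exact ⟨H [] (by simp), fun i => ih fun l hl => H (i :: l) (by simpa using hl)⟩

theorem exists_deltaWord_eq_deltaPow (l : List (Fin n)) :
    ∃ (β : Fin n →₀ ℕ) (l' : List (Fin n)), l.Perm l' ∧ ∀ r, h.deltaWord l' r = h.deltaPow β r := by
  have key : ∀ β : Fin n →₀ ℕ, ∃ l' : List (Fin n), (∀ i, l'.count i = β i) ∧
      ∀ r, h.deltaWord l' r = h.deltaPow β r := by
    intro β
    induction β using exponent_induction with
    | zero => exact ⟨[], by simp, fun r => (h.deltaPow_zero r).symm⟩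
    | step β j hj ih =>
      obtain ⟨l', hl', hr⟩ := ih
      refine ⟨l' ++ [j], fun i => ?_, fun r => ?_⟩
      · rw [List.count_append, hl', Finsupp.add_apply, Finsupp.single_apply, List.count_singleton]
        simp
      · rw [deltaWord_append, hr, h.deltaPow_add_single hj]
        rfl
  obtain ⟨l', hl', hr⟩ := key (Finsupp.equivFunOnFinite.symm fun i => l.count i)
  refine ⟨_, l', ?_, hr⟩
  rw [List.perm_iff_count]
  intro i
  rw [hl']
  rfl

namespace IsSigmaInvariantIdeal

variable {V : Set R}

/-- Unit factors on the left do not matter for words of length `k` on the `k`-th layer: the word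
hits the unit with a `δ` only in terms that have fewer than `k` letters left for `r`. -/
theorem deltaWord_unit_mul_mem_iff (hb : h.IsBijective) (hq : h.IsQuantized)
    (hV : h.IsSigmaInvariantIdeal V) (l : List (Fin n)) {d r : R} (hd : IsUnit d)
    (hr : r ∈ h.deltaLayer V l.length) : h.deltaWord l (d * r) ∈ V ↔ h.deltaWord l r ∈ V := by
  induction l generalizing d r with
  | nil => exact hV.unit_mul_mem_iff hd
  | cons i l ih =>
    have h1 : h.deltaWord l (h.delta i d * r) ∈ V :=
      (deltaWord_mem_deltaLayer (k := 1) ((hV.deltaLayer hb hq _).mul_mem_left _ hr)).1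
    simp only [deltaWord, delta_mul, deltaWord_add, hV.add_mem_iff_left h1]
    exact ih (h.isUnit_sigma i hd) (hr.2 i)

/-- On the `k`-th layer, words of length `k` in the `δᵢ` may be reordered without affecting whether
the value lies in `V`. -/
theorem deltaWord_mem_iff_of_perm (hb : h.IsBijective) (hq : h.IsQuantized)
    (hV : h.IsSigmaInvariantIdeal V) {l l' : List (Fin n)} (hl : l.Perm l') {r : R}
    (hr : r ∈ h.deltaLayer V l.length) : h.deltaWord l r ∈ V ↔ h.deltaWord l' r ∈ V := by
  induction hl generalizing r with
  | nil => rfl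
  | cons i _ ih => exact ih (hr.2 i)
  | swap i j l =>
    obtain ⟨d, e₀, e, hd, he⟩ := hb.exists_commutation j i
    have hk := hV.deltaLayer hb hq (l.length + 1)
    have h1 : h.deltaWord l (e₀ * r + ∑ k, e k * h.delta k r
        - h.sigma i (h.sigma j r) * e₀) ∈ V := by
      refine (deltaWord_mem_deltaLayer (k := 1) ?_).1
      refine hk.sub_mem (hk.add_mem (hk.mul_mem_left _ ?_) (hk.sum_mem fun k _ =>
        hk.mul_mem_left _ (hr.2 k))) (hk.mul_mem_right _ (hk.sigma_mem i (hk.sigma_mem j ?_))) <;>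
      exact deltaLayer_succ_subset V _ hr
    simp only [deltaWord]
    rw [(he r).2.1, add_assoc, add_sub_assoc, deltaWord_add, hV.add_mem_iff_left h1,
      hV.deltaWord_unit_mul_mem_iff hb hq l hd ((hr.2 i).2 j)]
  | trans h1 _ ih1 ih2 => exact (ih1 hr).trans (ih2 (h1.length_eq ▸ hr))

/-- `V_Δ` is the intersection of the layers of `V`: although `V_Δ` only refers to the ordered words
`δ ^ β`, an arbitrary word of length `k` may be reordered once its argument is known to lie in the
`k`-th layer. -/
theorem mem_deltaPart_iff (hb : h.IsBijective) (hq : h.IsQuantized)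
    (hV : h.IsSigmaInvariantIdeal V) (r : R) :
    r ∈ h.deltaPart V ↔ ∀ k, r ∈ h.deltaLayer V k := by
  constructor
  · intro hr k
    induction k with
    | zero => exact Set.mem_univ _
    | succ k ih =>
      refine mem_deltaLayer_of_deltaWord V fun l hl => ?_
      obtain ⟨β, l', hl', hβ⟩ := h.exists_deltaWord_eq_deltaPow l
      rw [hV.deltaWord_mem_iff_of_perm hb hq hl' (deltaLayer_anti V (by omega) ih), hβ]
      exact hr.2 β
  · intro H
    refine ⟨(H 1).1, fun β => ?_⟩
    have key : ∀ k, h.deltaPow β r ∈ h.deltaLayer V k := by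
      induction β using exponent_induction with
      | zero => simpa [deltaPow_zero] using H
      | step β j hj ih =>
        intro k
        rw [h.deltaPow_add_single hj]
        exact (ih (k + 1)).2 j
    exact (key 1).1

theorem deltaPart (hb : h.IsBijective) (hq : h.IsQuantized) (hV : h.IsSigmaInvariantIdeal V) :
    h.IsSigmaInvariantIdeal (h.deltaPart V) := by
  have := hV.mem_deltaPart_iff hb hq
  refine ⟨?_, ?_, ?_, ?_, ?_⟩ <;> intros <;> simp only [this] at * <;> intro k <;>
    have hk := hV.deltaLayer hb hq k
  · exact hk.zero_mem
  · exact hk.add_mem (by solve_by_elim) (by solve_by_elim)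
  · exact hk.mul_mem_left _ (by solve_by_elim)
  · exact hk.mul_mem_right _ (by solve_by_elim)
  · exact hk.sigma_mem _ (by solve_by_elim)

theorem delta_mem_deltaPart (hb : h.IsBijective) (hq : h.IsQuantized)
    (hV : h.IsSigmaInvariantIdeal V) (i : Fin n) {r : R} (hr : r ∈ h.deltaPart V) :
    h.delta i r ∈ h.deltaPart V := by
  rw [hV.mem_deltaPart_iff hb hq] at hr ⊢
  exact fun k => (hr (k + 1)).2 i

theorem sigma_mem_deltaPart_iff (hb : h.IsBijective) (hq : h.IsQuantized)
    (hV : h.IsSigmaInvariantIdeal V) (i : Fin n) (r : R) :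
    h.sigma i r ∈ h.deltaPart V ↔ r ∈ h.deltaPart (h.sigma i ⁻¹' V) := by
  simp only [hV.mem_deltaPart_iff hb hq, (hV.preimage_sigma hb i).mem_deltaPart_iff hb hq,
    hV.sigma_mem_deltaLayer_iff hb hq]

/-! ### Left submodules of `A` contained in `V⟨X⟩` -/

theorem mul_mem_polySet (hV : h.IsSigmaInvariantIdeal V) {p : R} (hp : p ∈ V) (a : A) :
    (p : A) * a ∈ h.polySet V := by
  intro α
  rw [coeff_coe_mul]
  exact hV.mul_mem_right _ hp

theorem sum_mem_polySet (hV : h.IsSigmaInvariantIdeal V) {ι : Type*} {s : Finset ι} {f : ι → A}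
    (hf : ∀ i ∈ s, f i ∈ h.polySet V) : ∑ i ∈ s, f i ∈ h.polySet V := by
  intro α
  rw [coeff_sum]
  exact hV.sum_mem fun i hi => hf i hi α

/-- Modulo `V⟨X⟩`, multiplication by `xᵢ` on the left acts on `V⟨X⟩` by `δᵢ` on the
coefficients. -/
theorem coeff_x_mul_mem_iff (hV : h.IsSigmaInvariantIdeal V) (i : Fin n) {a : A}
    (ha : a ∈ h.polySet V) (α : Fin n →₀ ℕ) :
    h.coeff (x i * a) α ∈ V ↔ h.delta i (h.coeff a α) ∈ V := by
  have e1 : x i * a = ∑ β ∈ (h.basis.repr a).support, (h.delta i (h.coeff a β) : A) * mon x β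
      + ∑ β ∈ (h.basis.repr a).support, (h.sigma i (h.coeff a β) : A) * (x i * mon x β) := by
    conv_lhs => rw [h.eq_sum_coeff a, Finset.mul_sum]
    rw [← Finset.sum_add_distrib]
    refine Finset.sum_congr rfl fun β _ => ?_
    rw [← mul_assoc, x_mul_coe h]
    noncomm_ring
  have e2 : h.coeff (∑ β ∈ (h.basis.repr a).support, (h.delta i (h.coeff a β) : A) * mon x β) α
      = h.delta i (h.coeff a α) := by
    simp only [coeff_sum, coeff_coe_mul, coeff_mon]
    rw [Finset.sum_eq_single α]
    · simp
    · intro β _ hβ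
      simp [hβ]
    · intro hα
      have : h.coeff a α = 0 := Finsupp.notMem_support_iff.1 hα
      simp [this, delta_zero]
  rw [e1, coeff_add, e2, hV.add_mem_iff_left]
  exact hV.sum_mem_polySet (fun β _ => hV.mul_mem_polySet (hV.sigma_mem i (ha β)) _) α

theorem mul_mem_polySet_of_delta (hV : h.IsSigmaInvariantIdeal V)
    (hδ : ∀ i, ∀ r ∈ V, h.delta i r ∈ V) {a : A} (ha : a ∈ h.polySet V) (b : A) :
    b * a ∈ h.polySet V := by
  have hmon : ∀ α : Fin n →₀ ℕ, mon x α * a ∈ h.polySet V := by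
    intro α
    induction α using exponent_induction with
    | zero => simpa [mon_zero] using ha
    | step α j hj ih =>
      rw [mon_add_single x hj, mul_assoc]
      exact fun β => (hV.coeff_x_mul_mem_iff j ih β).2 (hδ j _ (ih β))
  rw [h.eq_sum_coeff b, Finset.sum_mul]
  refine hV.sum_mem_polySet fun α _ β => ?_
  rw [mul_assoc, coeff_coe_mul]
  exact hV.mul_mem_left _ (hmon α β)

/-- A subset of `V⟨X⟩` that is stable under left multiplication by the variables lies in
`V_Δ⟨X⟩`. -/
theorem subset_polySet_deltaPart (hb : h.IsBijective) (hq : h.IsQuantized)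
    (hV : h.IsSigmaInvariantIdeal V) {L : Set A} (hL : ∀ i, ∀ a ∈ L, x i * a ∈ L)
    (hLV : L ⊆ h.polySet V) : L ⊆ h.polySet (h.deltaPart V) := by
  have key : ∀ k, ∀ a ∈ L, ∀ α, h.coeff a α ∈ h.deltaLayer V k := by
    intro k
    induction k with
    | zero => exact fun _ _ _ => Set.mem_univ _
    | succ k ih =>
      exact fun a ha α => ⟨hLV ha α, fun i =>
        ((hV.deltaLayer hb hq k).coeff_x_mul_mem_iff i (ih a ha) α).1 (ih _ (hL i a ha) α)⟩
  exact fun a ha α => (hV.mem_deltaPart_iff hb hq _).2 fun k => key k a ha α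

end IsSigmaInvariantIdeal

end IsSkewPBWExtension

/-! ### Prime modules and their annihilators -/

section PrimeModule

variable {S : Type*} [Ring S] {N : Type*} [AddCommGroup N] [Module Sᵐᵒᵖ N]

theorem mem_rightAnn {s : S} : s ∈ rightAnn S N ↔ ∀ v : N, op s • v = 0 :=
  TwoSidedIdeal.mem_mk' ..

theorem mem_rightAnn_submodule {N' : Submodule Sᵐᵒᵖ N} {s : S} :
    s ∈ rightAnn S N' ↔ ∀ v ∈ N', op s • v = 0 := by
  rw [mem_rightAnn]
  exact ⟨fun H v hv => congrArg Subtype.val (H ⟨v, hv⟩), fun H v => Subtype.ext (H v v.2)⟩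

theorem rightAnn_le_rightAnn_submodule (N' : Submodule Sᵐᵒᵖ N) {s : S} (hs : s ∈ rightAnn S N) :
    s ∈ rightAnn S N' :=
  mem_rightAnn_submodule.2 fun v _ => mem_rightAnn.1 hs v

theorem IsPrimeModule.mem_rightAnn_of_forall (hN : IsPrimeModule S N) {v : N} (hv : v ≠ 0) {s : S}
    (H : ∀ r : S, op (r * s) • v = 0) : s ∈ rightAnn S N := by
  rw [hN.2 (Submodule.span Sᵐᵒᵖ {v}) (by simpa using hv), mem_rightAnn_submodule]
  intro w hw
  obtain ⟨r, rfl⟩ := Submodule.mem_span_singleton.1 hw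
  rw [smul_smul]
  exact H r.unop

theorem IsPrimeModule.isPrimeIdeal_rightAnn (hN : IsPrimeModule S N) :
    IsPrimeIdeal (rightAnn S N) := by
  refine ⟨fun H => ?_, fun a b hab => or_iff_not_imp_left.2 fun ha => ?_⟩
  · have := hN.1
    obtain ⟨v, hv⟩ := exists_ne (0 : N)
    exact hv (by simpa using mem_rightAnn.1 H v)
  · rw [mem_rightAnn] at ha
    push Not at ha
    obtain ⟨v, hv⟩ := ha
    refine hN.mem_rightAnn_of_forall hv fun r => ?_
    rw [smul_smul, ← op_mul, ← mul_assoc]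
    exact mem_rightAnn.1 (hab r) v

theorem IsPrimeModule.top (hN : IsPrimeModule S N) :
    IsPrimeModule S (⊤ : Submodule Sᵐᵒᵖ N) := by
  have := hN.1
  refine ⟨Submodule.nontrivial_iff_ne_bot.2 top_ne_bot, fun N' hN' => ?_⟩
  have h1 := hN.2 (N'.map (⊤ : Submodule Sᵐᵒᵖ N).subtype)
    (fun H => hN' (Submodule.map_injective_of_injective (Submodule.injective_subtype _)
      (H.trans (Submodule.map_bot _).symm)))
  ext s
  constructor
  · exact rightAnn_le_rightAnn_submodule N'
  · intro hs
    have h2 : s ∈ rightAnn S N := by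
      rw [h1, mem_rightAnn_submodule]
      rintro _ ⟨v, hv, rfl⟩
      rw [← map_smul, mem_rightAnn_submodule.1 hs v hv, map_zero]
    exact rightAnn_le_rightAnn_submodule _ h2

theorem IsPrimeModule.assPrimes_eq (hN : IsPrimeModule S N) :
    assPrimes S N = {rightAnn S N} := by
  ext P
  constructor
  · rintro ⟨-, N', hN', rfl⟩
    have := hN'.1
    exact (hN.2 N' (Submodule.nontrivial_iff_ne_bot.1 hN'.1)).symm
  · rintro rfl
    have := hN.1
    exact ⟨hN.isPrimeIdeal_rightAnn, ⊤, hN.top, hN.2 _ top_ne_bot⟩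

end PrimeModule

variable {A : Type*} [Ring A] {R : Subring A} {n : ℕ} {x : Fin n → A}
  {h : IsSkewPBWExtension R x}

open IsSkewPBWExtension

/-! ### Leading terms of products -/

section LeadingTerms

variable {ord : MonomialOrder (Fin n)}

theorem DegreeCompatible.degree_le (hord : DegreeCompatible ord) {α β : Fin n →₀ ℕ}
    (hαβ : ord.toSyn α ≤ ord.toSyn β) : α.degree ≤ β.degree :=
  not_lt.1 fun H => absurd (hord _ _ H) (not_lt.2 hαβ)

theorem degreeCompatible_degLex :
    DegreeCompatible (MonomialOrder.degLex : MonomialOrder (Fin n)) := by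
  intro α β hαβ
  have : MonomialOrder.degLex.toSyn α < MonomialOrder.degLex.toSyn β ↔ _ :=
    MonomialOrder.degLex_lt_iff (a := α) (b := β)
  rw [this, Finsupp.DegLex.lt_iff]
  exact Or.inl hαβ

theorem coeff_mon_mul_coe_mul_mon (hb : h.IsBijective) (hord : DegreeCompatible ord)
    (α β : Fin n →₀ ℕ) : ∃ u : R, IsUnit u ∧
      (∀ r : R, h.coeff (mon x α * ((r : A) * mon x β)) (α + β) = h.sigmaPow α r * u) ∧
      ∀ (r : R) (γ : Fin n →₀ ℕ), ord.toSyn (α + β) < ord.toSyn γ →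
        h.coeff (mon x α * ((r : A) * mon x β)) γ = 0 := by
  obtain ⟨u, hu, H⟩ := hb.exists_mon_mul_coe_mul_mon α β
  refine ⟨u, hu, fun r => ?_, fun r γ hγ => ?_⟩
  · have := H r (α + β) (by rw [map_add])
    rwa [coeff_sub, coeff_coe_mul, coeff_mon, if_pos rfl, mul_one, sub_eq_zero] at this
  · have := H r γ (by rw [← map_add]; exact hord.degree_le hγ.le)
    rwa [coeff_sub, coeff_coe_mul, coeff_mon, if_neg (by rintro rfl; exact hγ.false), mul_zero,
      sub_zero] at this

/-- The leading term of `x ^ α a`, where `β` bounds the exponents of `a`. The unit does not depend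
on `a`. -/
theorem coeff_mon_mul (hb : h.IsBijective) (hord : DegreeCompatible ord)
    (α β : Fin n →₀ ℕ) : ∃ u : R, IsUnit u ∧ ∀ a : A,
      (∀ β', ord.toSyn β < ord.toSyn β' → h.coeff a β' = 0) →
      h.coeff (mon x α * a) (α + β) = h.sigmaPow α (h.coeff a β) * u ∧
      ∀ γ : Fin n →₀ ℕ, ord.toSyn (α + β) < ord.toSyn γ → h.coeff (mon x α * a) γ = 0 := by
  obtain ⟨u, hu, hu1, -⟩ := coeff_mon_mul_coe_mul_mon hb hord α β
  refine ⟨u, hu, fun a ha => ?_⟩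
  have hle : ∀ β' ∈ (h.basis.repr a).support, ord.toSyn β' ≤ ord.toSyn β := fun β' hβ' =>
    not_lt.1 fun H => Finsupp.mem_support_iff.1 hβ' (ha β' H)
  have hzero : ∀ β' γ, ord.toSyn (α + β') < ord.toSyn γ →
      h.coeff (mon x α * ((h.coeff a β' : A) * mon x β')) γ = 0 := fun β' γ hγ => by
    obtain ⟨_, -, -, hv⟩ := coeff_mon_mul_coe_mul_mon hb hord α β'
    exact hv _ γ hγ
  have hexp : ∀ γ, h.coeff (mon x α * a) γ = ∑ β' ∈ (h.basis.repr a).support,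
      h.coeff (mon x α * ((h.coeff a β' : A) * mon x β')) γ := fun γ => by
    conv_lhs => rw [h.eq_sum_coeff a, Finset.mul_sum, coeff_sum]
  constructor
  · rw [hexp, Finset.sum_eq_single β, hu1]
    · intro β' hβ' hne
      apply hzero
      rw [map_add, map_add]
      exact add_lt_add_right (lt_of_le_of_ne (hle β' hβ')
        (fun H => hne (ord.toSyn.injective H))) _
    · intro hβ
      have : h.coeff a β = 0 := Finsupp.notMem_support_iff.1 hβ
      simp [this, coeff_zero]
  · intro γ hγ
    rw [hexp]
    refine Finset.sum_eq_zero fun β' hβ' => hzero _ _ (lt_of_le_of_lt ?_ hγ)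
    rw [map_add, map_add]
    exact add_le_add_right (hle β' hβ') _

variable {M : Type*} [AddCommGroup M]

theorem toFinsupp_eq_zero_of_leadExp_lt {f : Induced h M} {α : Fin n →₀ ℕ}
    (hα : ord.toSyn (leadExp h ord f) < ord.toSyn α) : Induced.toFinsupp h f α = 0 := by
  by_contra H
  have h1 := Finset.le_sup (f := fun α => ord.toSyn α) (Finsupp.mem_support_iff.2 H)
  rw [leadExp, AddEquiv.apply_symm_apply] at hα
  exact absurd hα (not_lt.2 h1)

theorem toFinsupp_leadExp_ne_zero {f : Induced h M} (hf : f ≠ 0) :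
    Induced.toFinsupp h f (leadExp h ord f) ≠ 0 := by
  have hne : (Induced.toFinsupp h f).support.Nonempty := Finsupp.support_nonempty_iff.2 hf
  obtain ⟨α, hα, he⟩ := Finset.exists_mem_eq_sup _ hne fun α => ord.toSyn α
  rw [leadExp, he, AddEquiv.symm_apply_apply]
  exact Finsupp.mem_support_iff.1 hα

theorem leadExp_eq {f : Induced h M} {α : Fin n →₀ ℕ} (h1 : Induced.toFinsupp h f α ≠ 0)
    (h2 : ∀ α', ord.toSyn α < ord.toSyn α' → Induced.toFinsupp h f α' = 0) :
    leadExp h ord f = α := by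
  apply ord.toSyn.injective
  apply le_antisymm
  · refine not_lt.1 fun H => ?_
    refine toFinsupp_leadExp_ne_zero (ord := ord) (f := f) ?_ (h2 _ H)
    rintro rfl
    exact h1 rfl
  · exact not_lt.1 fun H => h1 (toFinsupp_eq_zero_of_leadExp_lt H)

variable [Module Rᵐᵒᵖ M]

theorem toFinsupp_smul (f : Induced h M) (a : A) (γ : Fin n →₀ ℕ) :
    Induced.toFinsupp h (op a • f) γ = ∑ α ∈ (Induced.toFinsupp h f).support,
      op (h.coeff (mon x α * a) γ) • Induced.toFinsupp h f α := by
  exact Finsupp.finsetSum_apply (Induced.toFinsupp h f).support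
    (fun α => (Induced.tmul h M (Induced.toFinsupp h f α) (mon x α * a) : (Fin n →₀ ℕ) →₀ M)) γ

/-- The leading term of `f a`, where `α` and `β` bound the exponents of `f` and `a`. The coefficient
of `f` at `α` or of `a` at `β` may vanish; the unit does not depend on `a`. -/
theorem toFinsupp_smul_add (hb : h.IsBijective) (hord : DegreeCompatible ord)
    {f : Induced h M} {α : Fin n →₀ ℕ}
    (hf : ∀ α', ord.toSyn α < ord.toSyn α' → Induced.toFinsupp h f α' = 0) (β : Fin n →₀ ℕ) :
    ∃ u : R, IsUnit u ∧ ∀ a : A, (∀ β', ord.toSyn β < ord.toSyn β' → h.coeff a β' = 0) →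
      Induced.toFinsupp h (op a • f) (α + β)
        = op (h.sigmaPow α (h.coeff a β) * u) • Induced.toFinsupp h f α ∧
      ∀ γ : Fin n →₀ ℕ, ord.toSyn (α + β) < ord.toSyn γ →
        Induced.toFinsupp h (op a • f) γ = 0 := by
  obtain ⟨u, hu, H⟩ := coeff_mon_mul hb hord α β
  refine ⟨u, hu, fun a ha => ?_⟩
  have hle : ∀ α' ∈ (Induced.toFinsupp h f).support, ord.toSyn α' ≤ ord.toSyn α := fun α' hα' =>
    not_lt.1 fun H => Finsupp.mem_support_iff.1 hα' (hf α' H)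
  constructor
  · rw [toFinsupp_smul, Finset.sum_eq_single α, (H a ha).1]
    · intro α' hα' hne
      obtain ⟨_, -, hv⟩ := coeff_mon_mul hb hord α' β
      rw [(hv a ha).2, op_zero, zero_smul]
      rw [map_add, map_add]
      exact add_lt_add_left (lt_of_le_of_ne (hle α' hα')
        (fun H => hne (ord.toSyn.injective H))) _
    · intro hα
      rw [Finsupp.notMem_support_iff.1 hα, smul_zero]
  · intro γ hγ
    rw [toFinsupp_smul]
    refine Finset.sum_eq_zero fun α' hα' => ?_
    obtain ⟨_, -, hv⟩ := coeff_mon_mul hb hord α' β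
    rw [(hv a ha).2, op_zero, zero_smul]
    refine lt_of_le_of_lt ?_ hγ
    rw [map_add, map_add]
    exact add_le_add_left (hle α' hα') _

/-! ### Good polynomials -/

theorem op_mul_unit_smul_eq_zero_iff {m : M} {s u : R} (hu : IsUnit u) :
    op (s * u) • m = 0 ↔ op s • m = 0 := by
  obtain ⟨u, rfl⟩ := hu
  rw [op_mul, mul_smul]
  refine ⟨fun H => ?_, fun H => by rw [H, smul_zero]⟩
  have := congrArg (op (↑u⁻¹ : R) • ·) H
  simpa [smul_smul, ← op_mul] using this

/-- Multiplication by `r ∈ R` does not raise the leading exponent, and it kills the leading term if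
and only if `σ ^ α (r)` kills the leading coefficient. -/
theorem toFinsupp_coe_smul (hb : h.IsBijective) (hord : DegreeCompatible ord) (f : Induced h M)
    (r : R) :
    (Induced.toFinsupp h (op (r : A) • f) (leadExp h ord f) = 0 ↔
        op (h.sigmaPow (leadExp h ord f) r) • Induced.toFinsupp h f (leadExp h ord f) = 0) ∧
      ∀ γ : Fin n →₀ ℕ, ord.toSyn (leadExp h ord f) < ord.toSyn γ →
        Induced.toFinsupp h (op (r : A) • f) γ = 0 := by
  obtain ⟨u, hu, H⟩ := toFinsupp_smul_add hb hord (f := f)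
    (fun α hα => toFinsupp_eq_zero_of_leadExp_lt hα) 0
  have hr := H r fun β hβ => by
    rw [coeff_coe, if_neg]
    rintro rfl
    exact hβ.false
  rw [add_zero, coeff_coe, if_pos rfl] at hr
  exact ⟨by rw [hr.1, op_mul_unit_smul_eq_zero_iff hu], hr.2⟩

/-- An element with minimal leading exponent in a submodule is a good polynomial. -/
theorem exists_isGoodPoly_mem (hb : h.IsBijective) (hord : DegreeCompatible ord)
    {N : Submodule Aᵐᵒᵖ (Induced h M)} (hN : N ≠ ⊥) : ∃ g ∈ N, IsGoodPoly h ord g := by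
  obtain ⟨f₀, hf₀, hf₀0⟩ := Submodule.exists_mem_ne_zero_of_ne_bot hN
  obtain ⟨g, ⟨hg, hg0⟩, hmin⟩ := WellFounded.has_min
    (InvImage.wf (fun f : Induced h M => ord.toSyn (leadExp h ord f)) wellFounded_lt)
    {f | f ∈ N ∧ f ≠ 0} ⟨f₀, hf₀, hf₀0⟩
  refine ⟨g, hg, hg0, fun r hr => ord.toSyn.injective (le_antisymm (not_lt.1 fun H => ?_) ?_)⟩
  · exact toFinsupp_leadExp_ne_zero hr ((toFinsupp_coe_smul hb hord g r).2 _ H)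
  · exact not_lt.1 (hmin _ ⟨N.smul_mem _ hg, hr⟩)

/-- The elements of `R` that annihilate a good polynomial are seen on its leading coefficient. -/
theorem IsGoodPoly.coe_smul_eq_zero_iff (hb : h.IsBijective) (hord : DegreeCompatible ord)
    {g : Induced h M} (hg : IsGoodPoly h ord g) (r : R) : op (r : A) • g = 0 ↔
      op (h.sigmaPow (leadExp h ord g) r) • Induced.toFinsupp h g (leadExp h ord g) = 0 := by
  rw [← (toFinsupp_coe_smul hb hord g r).1]
  constructor
  · intro H
    rw [H]
    rfl
  · intro H
    by_contra hne
    exact toFinsupp_leadExp_ne_zero hne (hg.2 r hne ▸ H)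

/-- If `g` is a good polynomial with leading exponent `α` over a prime module, then
`g R a = 0` forces `σ ^ α` to map all coefficients of `a` into the annihilator `P` of the module.
Goodness allows to discard the coefficients for which this holds, because they are annihilated by
`g R`; the leading term of what remains then contradicts primeness. -/
theorem IsGoodPoly.sigmaPow_coeff_mem (hb : h.IsBijective) (hord : DegreeCompatible ord)
    (hM : IsPrimeModule R M) {g : Induced h M} (hg : IsGoodPoly h ord g) {a : A}
    (ha : ∀ r : R, op ((r : A) * a) • g = 0) (β : Fin n →₀ ℕ) :
    h.sigmaPow (leadExp h ord g) (h.coeff a β) ∈ rightAnn R M := by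
  classical
  by_contra hβ
  set α := leadExp h ord g
  set m := Induced.toFinsupp h g α with hm
  set B := (h.basis.repr a).support.filter
    (fun β => h.sigmaPow α (h.coeff a β) ∉ rightAnn R M) with hB
  have hBne : B.Nonempty := by
    refine ⟨β, Finset.mem_filter.2 ⟨Finsupp.mem_support_iff.2 fun H => hβ ?_, hβ⟩⟩
    rw [coeff, H, sigmaPow_map_zero]
    exact zero_mem _
  obtain ⟨β₀, hβ₀, hmax⟩ := Finset.exists_max_image B ord.toSyn hBne
  set b : A := ∑ β ∈ B, (h.coeff a β : A) * mon x β with hb'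
  have hcoeff : ∀ γ, h.coeff b γ = if γ ∈ B then h.coeff a γ else 0 := by
    intro γ
    simp [hb', coeff_sum, coeff_coe_mul, coeff_mon]
  have hrb : ∀ r : R, op ((r : A) * b) • g = 0 := by
    intro r
    rw [← ha r]
    conv_rhs => rw [h.eq_sum_coeff a]
    rw [← Finset.sum_filter_add_sum_filter_not (h.basis.repr a).support
      (fun β => h.sigmaPow α (h.coeff a β) ∉ rightAnn R M), ← hB, ← hb', mul_add, op_add,
      add_smul, left_eq_add, Finset.mul_sum, Finset.op_sum, Finset.sum_smul]
    refine Finset.sum_eq_zero fun γ hγ => ?_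
    have hγ' := not_not.1 (Finset.mem_filter.1 hγ).2
    rw [← mul_assoc, op_mul, mul_smul, ← Subring.coe_mul,
      (hg.coe_smul_eq_zero_iff hb hord _).2, smul_zero]
    rw [sigmaPow_mul]
    exact mem_rightAnn.1 ((rightAnn R M).mul_mem_left _ _ hγ') _
  obtain ⟨u, hu, H⟩ := toFinsupp_smul_add hb hord (f := g)
    (fun α hα => toFinsupp_eq_zero_of_leadExp_lt hα) β₀
  refine (Finset.mem_filter.1 hβ₀).2 (hM.mem_rightAnn_of_forall (v := m)
    (toFinsupp_leadExp_ne_zero hg.1) fun s => ?_)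
  obtain ⟨r, rfl⟩ := hb.sigmaPow_surjective α s
  have h1 := (H ((r : A) * b) fun β' hβ' => by
    rw [coeff_coe_mul, hcoeff, if_neg, mul_zero]
    exact fun hB' => absurd hβ' (not_lt.2 (hmax _ hB'))).1
  rw [hrb, coeff_coe_mul, hcoeff, if_pos hβ₀, sigmaPow_mul] at h1
  exact (op_mul_unit_smul_eq_zero_iff hu).1 h1.symm

/-- A nonzero element of `M`, regarded as a constant polynomial, is good. -/
theorem exists_isGoodPoly_leadExp_zero (hb : h.IsBijective) (hord : DegreeCompatible ord)
    [Nontrivial M] : ∃ g : Induced h M, IsGoodPoly h ord g ∧ leadExp h ord g = 0 := by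
  obtain ⟨m, hm⟩ := exists_ne (0 : M)
  set g : Induced h M := (Finsupp.single 0 m : (Fin n →₀ ℕ) →₀ M) with hg
  have hlead : leadExp h ord g = 0 := by
    refine leadExp_eq ?_ fun α hα => ?_
    · change (Finsupp.single 0 m : (Fin n →₀ ℕ) →₀ M) 0 ≠ 0
      simpa using hm
    · refine Finsupp.single_eq_of_ne ?_
      rintro rfl
      exact hα.false
  refine ⟨g, ⟨?_, fun r hr => ?_⟩, hlead⟩
  · intro H
    have := congrArg (fun f => Induced.toFinsupp h f 0) H
    change (Finsupp.single 0 m : (Fin n →₀ ℕ) →₀ M) 0 = 0 at this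
    exact hm (by simpa using this)
  · have hle : ord.toSyn (leadExp h ord (op (r : A) • g)) ≤ ord.toSyn (leadExp h ord g) :=
      not_lt.1 fun H => toFinsupp_leadExp_ne_zero hr ((toFinsupp_coe_smul hb hord g r).2 _ H)
    rw [hlead, map_zero] at hle
    rw [hlead]
    exact ord.toSyn.injective ((le_antisymm hle bot_le).trans (map_zero _).symm)

end LeadingTerms

/-! ### Annihilators of submodules of the induced module -/

section Annihilators

variable {ord : MonomialOrder (Fin n)} {M : Type*} [AddCommGroup M] [Module Rᵐᵒᵖ M]

theorem x_mul_mem_rightAnn {N : Type*} [AddCommGroup N] [Module Aᵐᵒᵖ N] (i : Fin n) {a : A}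
    (ha : a ∈ (rightAnn A N : Set A)) : x i * a ∈ (rightAnn A N : Set A) :=
  (rightAnn A N).mul_mem_left _ _ ha

theorem sigmaPow_coeff_mem_of_mem_rightAnn (hb : h.IsBijective) (hord : DegreeCompatible ord)
    (hM : IsPrimeModule R M) {N : Submodule Aᵐᵒᵖ (Induced h M)} {g : Induced h M} (hgN : g ∈ N)
    (hg : IsGoodPoly h ord g) {a : A} (ha : a ∈ rightAnn A N) (β : Fin n →₀ ℕ) :
    h.sigmaPow (leadExp h ord g) (h.coeff a β) ∈ rightAnn R M := by
  refine hg.sigmaPow_coeff_mem hb hord hM (fun r => ?_) β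
  rw [op_mul, mul_smul]
  exact mem_rightAnn_submodule.1 ha _ (N.smul_mem _ hgN)

theorem polySet_subset_rightAnn {V : Set R} (hV : h.IsSigmaInvariantIdeal V)
    (hδ : ∀ i, ∀ r ∈ V, h.delta i r ∈ V) (hVP : V ⊆ (rightAnn R M : Set R)) :
    h.polySet V ⊆ (rightAnn A (Induced h M) : Set A) := by
  intro a ha
  refine mem_rightAnn.2 fun f => Finsupp.ext fun γ => ?_
  refine (toFinsupp_smul f a γ).trans (Finset.sum_eq_zero fun α _ => ?_)
  exact mem_rightAnn.1 (hVP (hV.mul_mem_polySet_of_delta hδ ha _ γ)) _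

/-- Primeness of the induced module together with its associated prime, from matching bounds on
the annihilators of its nonzero submodules. -/
theorem isPrimeModule_induced [Nontrivial M] {J : Set R}
    (h1 : h.polySet J ⊆ (rightAnn A (Induced h M) : Set A))
    (h2 : ∀ N : Submodule Aᵐᵒᵖ (Induced h M), N ≠ ⊥ → (rightAnn A N : Set A) ⊆ h.polySet J) :
    IsPrimeModule A (Induced h M) ∧
      ∃ Q : TwoSidedIdeal A, (Q : Set A) = h.polySet J ∧
        rightAnn A (Induced h M) = Q ∧ assPrimes A (Induced h M) = {Q} := by
  have hnt : Nontrivial (Induced h M) := inferInstanceAs (Nontrivial ((Fin n →₀ ℕ) →₀ M))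
  have hprime : IsPrimeModule A (Induced h M) := by
    refine ⟨hnt, fun N hN => ?_⟩
    ext a
    exact ⟨rightAnn_le_rightAnn_submodule N, fun ha => h1 (h2 N hN ha)⟩
  refine ⟨hprime, _, ?_, rfl, hprime.assPrimes_eq⟩
  refine Set.Subset.antisymm ?_ h1
  rw [hprime.2 ⊤ top_ne_bot]
  exact h2 ⊤ top_ne_bot

theorem rightAnn_isSigmaInvariantIdeal (hP : ∀ i, ∀ r ∈ rightAnn R M, h.sigma i r ∈ rightAnn R M) :
    h.IsSigmaInvariantIdeal (rightAnn R M : Set R) where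
  zero_mem := zero_mem _
  add_mem hr hs := add_mem hr hs
  mul_mem_left r _ hs := (rightAnn R M).mul_mem_left r _ hs
  mul_mem_right r _ hs := (rightAnn R M).mul_mem_right _ r hs
  sigma_mem i r hr := hP i r hr

theorem IsSkewPBWExtension.IsSigmaStable.sigma_mem_iff (hb : h.IsBijective) {I : Set R}
    (hI : h.IsSigmaStable I) (i : Fin n) (r : R) : h.sigma i r ∈ I ↔ r ∈ I := by
  conv_lhs => rw [← hI i]
  exact (hb.1 i).1.mem_set_image

theorem IsSkewPBWExtension.IsSigmaStable.sigmaPow_mem_iff (hb : h.IsBijective) {I : Set R}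
    (hI : h.IsSigmaStable I) (α : Fin n →₀ ℕ) (r : R) : h.sigmaPow α r ∈ I ↔ r ∈ I := by
  induction α using exponent_induction with
  | zero => rw [sigmaPow_zero]
  | step α j hj ih => rw [h.sigmaPow_add_single hj, hI.sigma_mem_iff hb, ih]

theorem rightAnn_subset_polySet_of_isSigmaStable (hb : h.IsBijective) (hM : IsPrimeModule R M)
    (hP : h.IsSigmaStable (rightAnn R M : Set R)) {N : Submodule Aᵐᵒᵖ (Induced h M)}
    (hN : N ≠ ⊥) : (rightAnn A N : Set A) ⊆ h.polySet (rightAnn R M : Set R) := by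
  obtain ⟨g, hgN, hg⟩ := exists_isGoodPoly_mem hb degreeCompatible_degLex hN
  intro a ha β
  exact (hP.sigmaPow_mem_iff hb _ _).1
    (sigmaPow_coeff_mem_of_mem_rightAnn hb degreeCompatible_degLex hM hgN hg ha β)

end Annihilators

/-! ### The ideal `P_Σ` -/

section SigmaPart

variable (h) in
/-- `P_Σ = {r | σ ^ α (r) ∈ P for all α}`, so that `P_{Σ,Δ} = (P_Σ)_Δ`. -/
def sigmaPart (P : Set R) : Set R := {r | ∀ α, h.sigmaPow α r ∈ P}

theorem sigmaDeltaPart_eq (P : Set R) : h.sigmaDeltaPart P = h.deltaPart (sigmaPart h P) := by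
  ext r
  refine ⟨fun H => ⟨fun α => ?_, fun β α => H.2 α β⟩, fun H => ⟨?_, fun α β => H.2 β α⟩⟩
  · simpa [deltaPow_zero] using H.2 α 0
  · simpa [sigmaPow_zero] using H.1 0

theorem sigmaPow_sigmaPow_mem_iff (hb : h.IsBijective) (P : TwoSidedIdeal R) (α β : Fin n →₀ ℕ)
    (r : R) : h.sigmaPow α (h.sigmaPow β r) ∈ P ↔ h.sigmaPow (α + β) r ∈ P := by
  obtain ⟨_, ⟨u, rfl⟩, hu⟩ := hb.exists_sigmaPow_sigmaPow α β
  constructor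
  · intro H
    have := P.mul_mem_left (↑u⁻¹) _ (P.mul_mem_right _ (u : R) H)
    rwa [hu, Units.inv_mul_cancel_left] at this
  · intro H
    have := P.mul_mem_right _ (↑u⁻¹) (P.mul_mem_left (u : R) _ H)
    rwa [← hu, Units.mul_inv_cancel_right] at this

theorem sigmaPart_isSigmaInvariantIdeal (hb : h.IsBijective) (P : TwoSidedIdeal R) :
    h.IsSigmaInvariantIdeal (sigmaPart h (P : Set R)) where
  zero_mem α := by
    rw [sigmaPow_map_zero]
    exact zero_mem P
  add_mem hr hs α := by
    rw [sigmaPow_add]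
    exact add_mem (S := TwoSidedIdeal R) (hr α) (hs α)
  mul_mem_left r s hs α := by
    rw [sigmaPow_mul]
    exact P.mul_mem_left _ _ (hs α)
  mul_mem_right r s hs α := by
    rw [sigmaPow_mul]
    exact P.mul_mem_right _ _ (hs α)
  sigma_mem i r hr α := by
    rw [← h.sigmaPow_single i]
    exact (sigmaPow_sigmaPow_mem_iff hb P _ _ r).2 (hr _)

variable {ord : MonomialOrder (Fin n)} {M : Type*} [AddCommGroup M] [Module Rᵐᵒᵖ M]

/-- In a good induced module the annihilator of `g A`, for a good polynomial `g` with leading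
exponent `α`, has all its coefficients in `σ ^ (-α) (P_{Σ,Δ})`: the good polynomials
with larger leading exponents in `g A` put the coefficients into `σ ^ (-α) (P_Σ)`, and the
annihilator is a left ideal. -/
theorem sigmaPow_coeff_mem_of_isGoodModule (hb : h.IsBijective) (hq : h.IsQuantized)
    (hord : DegreeCompatible ord) (hM : IsPrimeModule R M) (hgood : IsGoodModule h M ord)
    {g : Induced h M} (hg : IsGoodPoly h ord g) {a : A}
    (ha : a ∈ rightAnn A (Submodule.span Aᵐᵒᵖ {g})) (β : Fin n →₀ ℕ) :
    h.sigmaPow (leadExp h ord g) (h.coeff a β) ∈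
      h.deltaPart (sigmaPart h (rightAnn R M : Set R)) := by
  set α := leadExp h ord g with hα
  have hT := sigmaPart_isSigmaInvariantIdeal hb (rightAnn R M)
  have hTα := hT.preimage_sigmaPow hb α
  have hsub : (rightAnn A (Submodule.span Aᵐᵒᵖ {g}) : Set A) ⊆
      h.polySet (h.sigmaPow α ⁻¹' sigmaPart h (rightAnn R M : Set R)) := by
    intro b hb' γ ε
    obtain ⟨f, hf, hfgood, hfα⟩ := hgood g hg (ε + α) le_add_self
    exact (sigmaPow_sigmaPow_mem_iff hb _ ε α _).2
      (hfα ▸ sigmaPow_coeff_mem_of_mem_rightAnn hb hord hM hf hfgood hb' γ)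
  have hmem := hTα.subset_polySet_deltaPart hb hq (fun i a => x_mul_mem_rightAnn i) hsub ha β
  rw [hTα.mem_deltaPart_iff hb hq] at hmem
  rw [hT.mem_deltaPart_iff hb hq]
  exact fun k => hT.sigmaPow_mem_deltaLayer hb hq α (hmem k)

/-- If `g` is a good polynomial with leading exponent `eᵢ`, then `g A` is annihilated by
`σᵢ⁻¹ (P_{Σ,Δ})`. -/
theorem coe_mem_rightAnn_span (hb : h.IsBijective) (hq : h.IsQuantized)
    (hord : DegreeCompatible ord) {g : Induced h M} (hg : IsGoodPoly h ord g) {i : Fin n}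
    (hgi : leadExp h ord g = Finsupp.single i 1) {s : R}
    (hs : h.sigma i s ∈ h.deltaPart (sigmaPart h (rightAnn R M : Set R))) :
    (s : A) ∈ rightAnn A (Submodule.span Aᵐᵒᵖ {g}) := by
  have hT := sigmaPart_isSigmaInvariantIdeal hb (rightAnn R M)
  have hTi := hT.preimage_sigma hb i
  have hK := hTi.deltaPart hb hq
  rw [hT.sigma_mem_deltaPart_iff hb hq] at hs
  refine mem_rightAnn_submodule.2 fun v hv => ?_
  obtain ⟨b, rfl⟩ := Submodule.mem_span_singleton.1 hv
  have hbs : b.unop * (s : A) ∈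
      h.polySet (h.deltaPart (h.sigma i ⁻¹' sigmaPart h (rightAnn R M : Set R))) := by
    refine hK.mul_mem_polySet_of_delta (fun j r hr => hTi.delta_mem_deltaPart hb hq j hr) ?_ _
    have := hK.mul_mem_polySet hs 1
    rwa [mul_one] at this
  rw [smul_smul, show op (s : A) * b = op (b.unop * (s : A)) from rfl,
    h.eq_sum_coeff (b.unop * (s : A)), Finset.op_sum, Finset.sum_smul]
  refine Finset.sum_eq_zero fun β _ => ?_
  rw [op_mul, mul_smul, (hg.coe_smul_eq_zero_iff hb hord _).2, smul_zero]
  rw [hgi, sigmaPow_single]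
  have h1 := (hbs β).1 0
  rw [sigmaPow_zero] at h1
  exact mem_rightAnn.1 h1 _

end SigmaPart

end SkewPBW

end

open SkewPBW in
theorem theorem5p10 {A : Type*} [Ring A] (R : Subring A) {n : ℕ} (x : Fin n → A)
    (h : IsSkewPBWExtension R x) (hbij : h.IsBijective)
    (M : Type*) [AddCommGroup M] [Module Rᵐᵒᵖ M] (hM : IsPrimeModule R M)
    (P : TwoSidedIdeal R) (hP : P = rightAnn R M) :
    -- the first part
    (h.IsSigmaDeltaStable (P : Set R) →
      IsPrimeModule A (Induced h M) ∧
      ∃ Q : TwoSidedIdeal A, (Q : Set A) = h.polySet (P : Set R) ∧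
        rightAnn A (Induced h M) = Q ∧ assPrimes A (Induced h M) = {Q}) ∧
    -- the second part
    (h.IsQuantized → h.IsSigmaStable (P : Set R) →
      IsPrimeModule A (Induced h M) ∧
      ∃ Q : TwoSidedIdeal A, (Q : Set A) = h.polySet (h.deltaPart (P : Set R)) ∧
        rightAnn A (Induced h M) = Q ∧ assPrimes A (Induced h M) = {Q}) ∧
    -- the third part, for any degree compatible monomial order
    (∀ ord : MonomialOrder (Fin n), DegreeCompatible ord →
      h.IsQuantized → IsGoodModule h M ord →
      (IsPrimeModule A (Induced h M) ↔ h.IsSigmaStable (h.sigmaDeltaPart (P : Set R))) ∧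
      (IsPrimeModule A (Induced h M) →
        ∃ Q : TwoSidedIdeal A, (Q : Set A) = h.polySet (h.sigmaDeltaPart (P : Set R)) ∧
          rightAnn A (Induced h M) = Q ∧ assPrimes A (Induced h M) = {Q})) := by
  subst hP
  have hMnt : Nontrivial M := hM.1
  refine ⟨fun hP => ?_, fun hq hP => ?_, fun ord hord hq hgood => ?_⟩
  · have hPσ : h.IsSigmaStable (rightAnn R M : Set R) := fun i => (hP i).1
    exact isPrimeModule_induced
      (polySet_subset_rightAnn
        (rightAnn_isSigmaInvariantIdeal fun i r => (hPσ.sigma_mem_iff hbij i r).2)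
        (fun i r hr => (hP i).2 ⟨r, hr, rfl⟩) subset_rfl)
      fun N hN => rightAnn_subset_polySet_of_isSigmaStable hbij hM hPσ hN
  · have hV := rightAnn_isSigmaInvariantIdeal fun i r => (hP.sigma_mem_iff hbij i r).2
    exact isPrimeModule_induced
      (polySet_subset_rightAnn (hV.deltaPart hbij hq)
        (fun i r hr => hV.delta_mem_deltaPart hbij hq i hr) fun r hr => hr.1)
      fun N hN => hV.subset_polySet_deltaPart hbij hq (fun i a => x_mul_mem_rightAnn i)
        (rightAnn_subset_polySet_of_isSigmaStable hbij hM hP hN)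
  · rw [sigmaDeltaPart_eq]
    have hT := sigmaPart_isSigmaInvariantIdeal hbij (rightAnn R M)
    have hJ := hT.deltaPart hbij hq
    obtain ⟨g₀, hg₀, hlead₀⟩ := exists_isGoodPoly_leadExp_zero (M := M) hbij hord
    have hle : h.polySet (h.deltaPart (sigmaPart h (rightAnn R M : Set R))) ⊆
        (rightAnn A (Induced h M) : Set A) := by
      refine polySet_subset_rightAnn hJ (fun i r hr => hT.delta_mem_deltaPart hbij hq i hr) ?_
      intro r hr
      have := hr.1 0
      rwa [h.sigmaPow_zero] at this
    have hge : (rightAnn A (Induced h M) : Set A) ⊆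
        h.polySet (h.deltaPart (sigmaPart h (rightAnn R M : Set R))) := by
      intro a ha β
      have := sigmaPow_coeff_mem_of_isGoodModule hbij hq hord hM hgood hg₀
        (rightAnn_le_rightAnn_submodule _ ha) β
      rwa [hlead₀, h.sigmaPow_zero] at this
    refine ⟨⟨fun hprime i => ?_, fun hst => ?_⟩, fun hprime => ?_⟩
    · obtain ⟨g, -, hg, hgi⟩ := hgood g₀ hg₀ (Finsupp.single i 1) (hlead₀ ▸ zero_le)
      refine Set.Subset.antisymm (Set.image_subset_iff.2 fun r => hJ.sigma_mem i) fun r hr => ?_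
      obtain ⟨s, rfl⟩ := (hbij.1 i).2 r
      refine ⟨s, ?_, rfl⟩
      have hs := coe_mem_rightAnn_span hbij hq hord hg hgi hr
      rw [← hprime.2 _ (by simpa using hg.1)] at hs
      have := hge hs 0
      rwa [h.coeff_coe, if_pos rfl] at this
    · refine (isPrimeModule_induced hle fun N hN a ha β => ?_).1
      obtain ⟨g, hgN, hg⟩ := exists_isGoodPoly_mem hbij hord hN
      refine (hst.sigmaPow_mem_iff hbij _ _).1
        (sigmaPow_coeff_mem_of_isGoodModule hbij hq hord hM hgood hg ?_ β)
      exact mem_rightAnn_submodule.2 fun v hv => mem_rightAnn_submodule.1 ha v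
        ((Submodule.span_singleton_le_iff_mem _ _).2 hgN hv)
    · exact ⟨_, Set.Subset.antisymm hge hle, rfl, hprime.assPrimes_eq⟩
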